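/- For real $x,y,z$ let $$E(x,y,z)=\frac1{2\pi}\iint_{\mathbb R^2}\exp\{-i(x\xi+y\eta)-iz(\xi^2+\eta^2)+i(\xi^3-3\xi\eta^2)\}\,d\xi\,d\eta$$ be the elliptic umbilic integral, understood as an improper double integral: the limit of the integrals over rectangles $[a_1,b_1]\times[a_2,b_2]$ as $a_1,a_2\to-\infty$ and $b_1,b_2\to+\infty$ independently. Let $\omega=e^{2\pi i/3}$, let $(a)_n=a(a+1)\cdots(a+n-1)$, and let $${}_pF_q(a_1,\dots,a_p;b_1,\dots,b_q\mid x)=\sum_{n\ge0}\frac{(a_1)_n\cdots(a_p)_n}{(b_1)_n\cdots(b_q)_n}\frac{x^n}{n!}.$$ Then for all real $c$ and $z$ the integrals defining $E(cz^2,0,z)$ and $E(-cz^2/3,0,z)$ converge, the following series over $k$ converge absolutely, and $$E(cz^2,0,z)=\frac{2\sqrt\pi}{3\sqrt3}\exp\Big([9c-4]\frac{iz^3}{27}\Big)\sum_{k\ge0}\{\operatorname{Im}\omega^{k+1}\}\frac{(2iz)^k}{\Gamma(\frac{5-4k}6)\,k!}\;{}_2F_1\Big(\frac{-k}2,\frac{1-k}2;\frac{5-4k}6\;\Big|\;1-c\Big),$$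 $$E\Big(-\frac{cz^2}3,0,z\Big)=\frac{2\sqrt\pi}{3\sqrt3}\exp\Big([3c-2]\frac{iz^3}{27}\Big)\sum_{k\ge0}\{\operatorname{Im}\omega^{k+1}\}\frac{(\frac12)_k(\frac23iz)^k}{\Gamma(\frac{5+2k}6)\,k!}\;{}_3F_2\Big(\frac{-k}2,\frac{1-k}2,\frac{1-2k}6;\frac{1-2k}4,\frac{3-2k}4\;\Big|\;\frac34[1-c]\Big),$$ where the ${}_2F_1$ and ${}_3F_2$ series terminate, since one of $-k/2$, $(1-k)/2$ is a nonpositive integer. Moreover, for $c=0$ the right side of the first formula equals the Berry–Howls expression, so that for all real $z$ $$E(0,0,z)=\frac{\sqrt\pi}3\exp\Big(-\frac{2iz^3}{27}\Big)\Big\{\frac1{\Gamma(\frac56)}\,{}_0F_1\Big(\frac56\;\Big|\;-\frac{z^6}{3^6}\Big)-\frac{iz}{3\Gamma(\frac76)}\,{}_0F_1\Big(\frac76\;\Big|\;-\frac{z^6}{3^6}\Big)\Big\}.$$ -/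

import Mathlib

noncomputable section

/-- The Fourier integral `(1/2π) ∬ exp(-i(xξ + yη)) f(ξ, η) dξ dη` truncated to the rectangle
`[a.1, b.1] × [a.2, b.2]`. -/
def fourierBox (f : ℝ → ℝ → ℂ) (x y : ℝ) (a b : ℝ × ℝ) : ℂ :=
  1 / (2 * (Real.pi : ℂ)) * ∫ p in Set.Icc a b,
    Complex.exp (-Complex.I * ((x : ℂ) * (p.1 : ℂ) + (y : ℂ) * (p.2 : ℂ))) * f p.1 p.2

/-- The rectangles exhaust the plane, their four sides going to infinity independently. -/
def boxFilter : Filter ((ℝ × ℝ) × (ℝ × ℝ)) := Filter.atBot ×ˢ Filter.atTop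

/-- The 2D Fourier integral of `f` at `(x, y)` exists as an improper (conditionally convergent)
double integral. -/
def FourierConverges (f : ℝ → ℝ → ℂ) (x y : ℝ) : Prop :=
  ∃ v : ℂ, Filter.Tendsto (fun q => fourierBox f x y q.1 q.2) boxFilter (nhds v)

/-- The 2D Fourier transform, with factor `1/(2π)`, as an improper double integral. -/
def fourierPlane (f : ℝ → ℝ → ℂ) (x y : ℝ) : ℂ :=
  Filter.limUnder boxFilter (fun q => fourierBox f x y q.1 q.2)

/-- `exp(-iz(ξ² + η²) + i(ξ³ - 3ξη²))`. -/
def umbilicInitial (z ξ η : ℝ) : ℂ :=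
  Complex.exp (-Complex.I * (z : ℂ) * ((ξ : ℂ) ^ 2 + (η : ℂ) ^ 2)
    + Complex.I * ((ξ : ℂ) ^ 3 - 3 * (ξ : ℂ) * (η : ℂ) ^ 2))

/-- The improper integral that defines the elliptic umbilic `E(x, y, z)` converges. -/
def UmbilicConverges (x y z : ℝ) : Prop := FourierConverges (umbilicInitial z) x y

/-- The elliptic umbilic integral `E(x, y, z)`. -/
def ellipticUmbilic (x y z : ℝ) : ℂ := fourierPlane (umbilicInitial z) x y

/-- The generalized hypergeometric series `pFq(as; bs | x)`, with upper parameters `as` and lower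
parameters `bs`. -/
def genHypergeometric (as bs : List ℂ) (x : ℂ) : ℂ :=
  ∑' n : ℕ, (as.map fun a => (ascPochhammer ℂ n).eval a).prod /
    (bs.map fun b => (ascPochhammer ℂ n).eval b).prod * x ^ n / (n.factorial : ℂ)

/-- The cubic root of unity `ω = exp(2πi/3)`. -/
def omegaRoot : ℂ := Complex.exp (2 * (Real.pi : ℂ) * Complex.I / 3)

/-- The factor `(2√π / (3√3)) exp([9c - 4] iz³/27)`. -/
def rightPrefactor (c z : ℝ) : ℂ :=
  2 * (Real.sqrt Real.pi : ℂ) / (3 * (Real.sqrt 3 : ℂ)) *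
    Complex.exp ((9 * (c : ℂ) - 4) * (Complex.I * (z : ℂ) ^ 3 / 27))

/-- `Im ω^{k+1} · (2iz)^k / (Γ((5-4k)/6) k!) · ₂F₁(-k/2, (1-k)/2; (5-4k)/6 | 1-c)`. -/
def rightTerm (c z : ℝ) (k : ℕ) : ℂ :=
  ((omegaRoot ^ (k + 1)).im : ℂ) * (2 * Complex.I * (z : ℂ)) ^ k /
      (Complex.Gamma ((5 - 4 * (k : ℂ)) / 6) * (k.factorial : ℂ)) *
    ordinaryHypergeometric (-(k : ℂ) / 2) ((1 - (k : ℂ)) / 2) ((5 - 4 * (k : ℂ)) / 6)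
      (1 - (c : ℂ))

/-- The factor `(2√π / (3√3)) exp([3c - 2] iz³/27)`. -/
def leftPrefactor (c z : ℝ) : ℂ :=
  2 * (Real.sqrt Real.pi : ℂ) / (3 * (Real.sqrt 3 : ℂ)) *
    Complex.exp ((3 * (c : ℂ) - 2) * (Complex.I * (z : ℂ) ^ 3 / 27))

/-- `Im ω^{k+1} · (1/2)_k (2iz/3)^k / (Γ((5+2k)/6) k!) ·
₃F₂(-k/2, (1-k)/2, (1-2k)/6; (1-2k)/4, (3-2k)/4 | 3(1-c)/4)`. -/
def leftTerm (c z : ℝ) (k : ℕ) : ℂ :=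
  ((omegaRoot ^ (k + 1)).im : ℂ) *
      ((ascPochhammer ℂ k).eval (1 / 2) * (2 / 3 * Complex.I * (z : ℂ)) ^ k) /
      (Complex.Gamma ((5 + 2 * (k : ℂ)) / 6) * (k.factorial : ℂ)) *
    genHypergeometric [-(k : ℂ) / 2, (1 - (k : ℂ)) / 2, (1 - 2 * (k : ℂ)) / 6]
      [(1 - 2 * (k : ℂ)) / 4, (3 - 2 * (k : ℂ)) / 4] (3 / 4 * (1 - (c : ℂ)))

/-- The Berry–Howls expression
`(√π/3) exp(-2iz³/27) {₀F₁(5/6 | -z⁶/3⁶)/Γ(5/6) - (iz/(3Γ(7/6))) ₀F₁(7/6 | -z⁶/3⁶)}`. -/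
def berryHowls (z : ℝ) : ℂ :=
  (Real.sqrt Real.pi : ℂ) / 3 * Complex.exp (-(2 * Complex.I * (z : ℂ) ^ 3 / 27)) *
    (1 / Complex.Gamma (5 / 6) * genHypergeometric [] [5 / 6] (-((z : ℂ) ^ 6 / 3 ^ 6))
      - Complex.I * (z : ℂ) / (3 * Complex.Gamma (7 / 6)) *
        genHypergeometric [] [7 / 6] (-((z : ℂ) ^ 6 / 3 ^ 6)))

end

/-! For y = 0 the substitution ξ = t - z/3 removes the term zη² and leaves, up to a constant, the
phase t³ - 2zt² + (z² - x)t - 3tη². The η-integral is then a Fresnel integral proportional to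
|t|^(-1/2), and t = ±u² turns the double integral into integrals of exp(i(u⁶ + pu⁴ + qu²)) over a
half-line. Rotated by π/12 these converge absolutely (`rayIntegral`); the half-plane t < 0 gives the
complex conjugate with p replaced by -p. The analytic difficulty is that the four sides of the
rectangle move independently. It is met by `exists_norm_fresnel_error_le`, which bounds the cost of
completing the η-integral uniformly in the length of the other side. Hence `ellipticUmbilic_eq`.

The two formulas are two expansions of the same ray integrals. The first expands the exponential in
p and q around exp(iu⁶); the moments are Gamma values, and since p = ∓2z and q = (1-c)z² the terms
are grouped by the power k of z. The second first completes the cube, so that the remaining linear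
coefficient is r = -(1-c)z²/3. It then expands in r and in the shift h = p/3. Here the moments
M_n(h) satisfy M_n' = n M_{n-1} + 3i M_{n+2}, which determines all their Taylor coefficients
(`iteratedDeriv_shiftedMoment`). In both cases a ray and its conjugate partner add up to a Gamma
value times a cosine of a multiple of π/6, and the reflection formula turns this into Im ω^{k+1}
divided by a Gamma value (`right_Gamma`, `left_Gamma`).

For c = 0 the ₂F₁ is evaluated at 1 by Chu–Vandermonde, and the values obey a two-term recurrence
with step 3 (`gaussValue_add_three`). The class k ≡ 2 mod 3 drops out because ω³ = 1. The other two
are the series ₁F₁(a; 2a) with a = 1/3 and a = 2/3, which `kummer_second` turns into an exponential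
times ₀F₁. -/

open Complex MeasureTheory Filter Topology Set

/-! ### Rotation of a ray of integration. -/

/-- `∫_0^α e^{-lθ} dθ ≤ 1/l`. -/
lemma integral_exp_neg_mul_le {α l : ℝ} (hl : 0 < l) :
    ∫ θ in (0 : ℝ)..α, Real.exp (-(l * θ)) ≤ 1 / l := by
  have h : ∀ x ∈ uIcc 0 α, HasDerivAt (fun θ => -(Real.exp (-(l * θ)) / l))
      (Real.exp (-(l * x))) x := by
    intro x _
    have := ((((hasDerivAt_id x).const_mul l).neg.exp).div_const l).neg
    refine this.congr_deriv ?_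
    simp only [Pi.neg_apply, id]
    field_simp
  rw [intervalIntegral.integral_eq_sub_of_hasDerivAt h
    (Continuous.intervalIntegrable (by fun_prop) _ _)]
  have := Real.exp_pos (-(l * α))
  have h2 : 0 ≤ Real.exp (-(l * α)) / l := by positivity
  simp only [mul_zero, neg_zero, Real.exp_zero]
  linarith

/-- Rotating the ray of integration of an entire function costs an integral over an arc. -/
lemma norm_integral_sub_rotated_le {f : ℂ → ℂ} (hf : Differentiable ℂ f) {V α l : ℝ} (hV : 0 ≤ V)
    (hα : 0 ≤ α) (hl : 0 < l)
    (hb : ∀ θ ∈ Icc 0 α, ‖f (V * exp (θ * I))‖ ≤ Real.exp (-(l * θ))) :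
    ‖(∫ v in (0 : ℝ)..V, f v) - exp (α * I) * ∫ s in (0 : ℝ)..V, f (exp (α * I) * s)‖
      ≤ V / l := by
  -- A global primitive plays the role of Cauchy's theorem on the sector: the integrals over both
  -- rays and the arc are increments of `G`.
  obtain ⟨G, hG⟩ := hf.isExactOn_univ
  have hG' : ∀ z, HasDerivAt G (f z) z := fun z => hG z (mem_univ z)
  have hc := hf.continuous
  have h1 : ∫ v in (0 : ℝ)..V, f v = G V - G 0 := by
    rw [intervalIntegral.integral_eq_sub_of_hasDerivAt (f := fun v : ℝ => G v)
      (fun x _ => (hG' x).comp_ofReal) (Continuous.intervalIntegrable (by fun_prop) _ _)]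
    simp
  have h2 : exp (α * I) * ∫ s in (0 : ℝ)..V, f (exp (α * I) * s) = G (exp (α * I) * V) - G 0 := by
    rw [← intervalIntegral.integral_const_mul,
      intervalIntegral.integral_eq_sub_of_hasDerivAt (f := fun v : ℝ => G (exp (α * I) * v))
      (fun x _ => ?_) (Continuous.intervalIntegrable (by fun_prop) _ _)]
    · simp
    · have := (hG' (exp (α * I) * x)).comp (x : ℂ) ((hasDerivAt_id (x : ℂ)).const_mul (exp (α * I)))
      refine this.comp_ofReal.congr_deriv ?_
      ring
  have h3 : ∫ θ in (0 : ℝ)..α, f (V * exp (θ * I)) * (V * (exp (θ * I) * I)) =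
      G (V * exp (α * I)) - G V := by
    rw [intervalIntegral.integral_eq_sub_of_hasDerivAt (f := fun θ : ℝ => G (V * exp (θ * I)))
      (fun x _ => ?_) (Continuous.intervalIntegrable (by fun_prop) _ _)]
    · simp
    · have := (hG' (V * exp (x * I))).comp (x : ℂ)
        ((((hasDerivAt_id (x : ℂ)).mul_const I).cexp).const_mul (V : ℂ))
      refine this.comp_ofReal.congr_deriv ?_
      simp
  have h4 : (∫ v in (0 : ℝ)..V, f v) - exp (α * I) * ∫ s in (0 : ℝ)..V, f (exp (α * I) * s) =
      -∫ θ in (0 : ℝ)..α, f (V * exp (θ * I)) * (V * (exp (θ * I) * I)) := by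
    rw [h1, h2, h3, mul_comm (V : ℂ)]
    ring
  rw [h4, norm_neg]
  calc ‖∫ θ in (0 : ℝ)..α, f (V * exp (θ * I)) * (V * (exp (θ * I) * I))‖
      ≤ ∫ θ in (0 : ℝ)..α, Real.exp (-(l * θ)) * V := by
        refine intervalIntegral.norm_integral_le_of_norm_le hα (Eventually.of_forall fun θ hθ => ?_)
          (Continuous.intervalIntegrable (by fun_prop) _ _)
        rw [norm_mul, norm_mul, norm_mul, norm_exp_ofReal_mul_I, norm_I, norm_real,
          Real.norm_of_nonneg hV, mul_one, mul_one]
        exact mul_le_mul_of_nonneg_right (hb θ ⟨hθ.1.le, hθ.2⟩) hV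
    _ ≤ 1 / l * V := by
        rw [intervalIntegral.integral_mul_const]
        exact mul_le_mul_of_nonneg_right (integral_exp_neg_mul_le hl) hV
    _ = V / l := by ring

/-! ### Fresnel integrals and their remainders. -/

/-- The truncated Fresnel integral. -/
noncomputable def fresnel (y : ℝ) : ℂ := ∫ v in (0 : ℝ)..y, exp (-(3 * I * (v : ℂ) ^ 2))

/-- The complete Fresnel integral. -/
noncomputable def fresnelLimit : ℂ := exp (-(Real.pi / 4 * I)) * ((Real.sqrt (Real.pi / 3) / 2 : ℝ) : ℂ)

lemma hasDerivAt_fresnel (y : ℝ) : HasDerivAt fresnel (exp (-(3 * I * (y : ℂ) ^ 2))) y :=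
  intervalIntegral.integral_hasDerivAt_right (Continuous.intervalIntegrable (by fun_prop) _ _)
    (Continuous.stronglyMeasurableAtFilter (by fun_prop) _ _)
    (Continuous.continuousAt (by fun_prop))

lemma continuous_fresnel : Continuous fresnel :=
  continuous_iff_continuousAt.2 fun y => (hasDerivAt_fresnel y).continuousAt

/-- The tail of exp(-3s²) is compared with that of s⁻², which integrates to 1/y. -/
lemma gaussian_tail_le {y : ℝ} (hy : 0 < y) :
    ‖Real.sqrt (Real.pi / 3) / 2 - ∫ s in (0 : ℝ)..y, Real.exp (-3 * s ^ 2)‖ ≤ 1 / y := by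
  have hi : IntegrableOn (fun s : ℝ => Real.exp (-3 * s ^ 2)) (Ioi 0) :=
    (integrable_exp_neg_mul_sq (by norm_num)).integrableOn
  have hi2 : IntegrableOn (fun s : ℝ => Real.exp (-3 * s ^ 2)) (Ioi y) :=
    (integrable_exp_neg_mul_sq (by norm_num)).integrableOn
  have e : Real.sqrt (Real.pi / 3) / 2 - ∫ s in (0 : ℝ)..y, Real.exp (-3 * s ^ 2) =
      ∫ s in Ioi y, Real.exp (-3 * s ^ 2) := by
    rw [← integral_gaussian_Ioi, ← intervalIntegral.integral_interval_add_Ioi hi hi2]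
    ring
  rw [e, Real.norm_of_nonneg (integral_nonneg fun _ => (Real.exp_pos _).le)]
  have h2 : ∫ s in Ioi y, s ^ (-2 : ℝ) = 1 / y := by
    rw [integral_Ioi_rpow_of_lt (by norm_num) hy]
    norm_num [Real.rpow_neg_one]
  rw [← h2]
  refine setIntegral_mono_on hi2 (integrableOn_Ioi_rpow_of_lt (by norm_num) hy) measurableSet_Ioi ?_
  intro s hs
  have hs0 : 0 < s := hy.trans hs
  rw [Real.rpow_neg hs0.le, neg_mul, Real.exp_neg]
  refine inv_anti₀ (by positivity) ?_
  have := Real.add_one_le_exp (3 * s ^ 2)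
  norm_num
  nlinarith [sq_nonneg s]

/-- A rotation by π/4 makes exp(3iv²) a real Gaussian, and Jordan's inequality sin 2θ ≥ 4θ/π
controls the arc. The conjugate integral is used because the rotation lemma turns counterclockwise.
Arc and Gaussian tail cost 1/y each. -/
lemma fresnel_sub_le {y : ℝ} (hy : 0 < y) : ‖fresnelLimit - fresnel y‖ ≤ 2 / y := by
  have hr := norm_integral_sub_rotated_le (f := fun v => exp (3 * I * v ^ 2)) (by fun_prop)
    (V := y) (α := Real.pi / 4) (l := 3 * y ^ 2 * (4 / Real.pi)) hy.le (by positivity)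
    (by positivity) (fun θ hθ => by
      rw [norm_exp, Real.exp_le_exp]
      have e : 3 * I * (y * exp (θ * I)) ^ 2 = ((3 * y ^ 2 : ℝ) : ℂ) * (I * exp ((2 * θ : ℝ) * I)) := by
        rw [mul_pow, ← Complex.exp_nat_mul]
        push_cast
        ring_nf
      have h1 := Real.mul_le_sin (x := 2 * θ) (by linarith [hθ.1]) (by linarith [hθ.2])
      rw [e, re_ofReal_mul, I_mul_re, exp_ofReal_mul_I_im]
      have h0 : 0 ≤ 3 * y ^ 2 := by positivity
      have h2 := mul_le_mul_of_nonneg_left h1 h0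
      have h3 : 3 * y ^ 2 * (2 / Real.pi * (2 * θ)) = 3 * y ^ 2 * (4 / Real.pi) * θ := by ring
      linarith)
  have hpi : exp (((Real.pi / 4 : ℝ) : ℂ) * I) ^ 2 = I := by
    rw [← Complex.exp_nat_mul]
    conv_rhs => rw [← exp_pi_div_two_mul_I]
    push_cast
    ring_nf
  have e1 : ∫ v in (0 : ℝ)..y, exp (3 * I * (v : ℂ) ^ 2) = (starRingEnd ℂ) (fresnel y) := by
    rw [fresnel, ← intervalIntegral.intervalIntegral_conj]
    congr 1
    ext v
    rw [← exp_conj]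
    simp [conj_ofReal, map_ofNat (starRingEnd ℂ) 3]
  have e2 : ∫ s in (0 : ℝ)..y, exp (3 * I * (exp (((Real.pi / 4 : ℝ) : ℂ) * I) * s) ^ 2) =
      ((∫ s in (0 : ℝ)..y, Real.exp (-3 * s ^ 2) : ℝ) : ℂ) := by
    rw [← intervalIntegral.integral_ofReal]
    congr 1
    ext s
    rw [mul_pow, hpi]
    push_cast
    congr 1
    linear_combination 3 * (s : ℂ) ^ 2 * I_sq
  have e3 : (starRingEnd ℂ) fresnelLimit =
      exp (((Real.pi / 4 : ℝ) : ℂ) * I) * ((Real.sqrt (Real.pi / 3) / 2 : ℝ) : ℂ) := by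
    rw [fresnelLimit, map_mul, ← exp_conj, conj_ofReal,
      show -((Real.pi : ℂ) / 4 * I) = ((-(Real.pi / 4) : ℝ) : ℂ) * I by push_cast; ring,
      map_mul, conj_ofReal, conj_I]
    push_cast
    ring_nf
  rw [e1, e2] at hr
  have e4 : (starRingEnd ℂ) (fresnelLimit - fresnel y) =
      -((starRingEnd ℂ) (fresnel y) - exp (((Real.pi / 4 : ℝ) : ℂ) * I) *
        ((∫ s in (0 : ℝ)..y, Real.exp (-3 * s ^ 2) : ℝ) : ℂ)) +
      exp (((Real.pi / 4 : ℝ) : ℂ) * I) *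
        ((Real.sqrt (Real.pi / 3) / 2 - ∫ s in (0 : ℝ)..y, Real.exp (-3 * s ^ 2) : ℝ) : ℂ) := by
    rw [map_sub, e3]
    push_cast
    ring
  rw [← RCLike.norm_conj, e4]
  refine (norm_add_le _ _).trans ?_
  rw [norm_neg, norm_mul, norm_exp_ofReal_mul_I, one_mul, norm_real]
  have h5 : y / (3 * y ^ 2 * (4 / Real.pi)) ≤ 1 / y := by
    rw [div_le_div_iff₀ (by positivity) hy]
    have h6 : Real.pi ≤ 4 := Real.pi_le_four
    have h7 : 1 ≤ 4 / Real.pi := by rw [le_div_iff₀ Real.pi_pos]; linarith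
    nlinarith [mul_le_mul_of_nonneg_left h7 (sq_nonneg y)]
  calc _ ≤ 1 / y + 1 / y := add_le_add (hr.trans h5) (gaussian_tail_le hy)
    _ = 2 / y := by ring

lemma fresnel_sub_bounded {y : ℝ} (hy : 0 ≤ y) : ‖fresnelLimit - fresnel y‖ ≤ 4 := by
  rcases le_total 1 y with h | h
  · refine (fresnel_sub_le (by linarith)).trans ?_
    rw [div_le_iff₀ (by linarith)]
    linarith
  · have h1 : ‖fresnel 1 - fresnel y‖ ≤ 1 := by
      rw [fresnel, fresnel, intervalIntegral.integral_interval_sub_left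
        (Continuous.intervalIntegrable (by fun_prop) _ _)
        (Continuous.intervalIntegrable (by fun_prop) _ _)]
      refine (intervalIntegral.norm_integral_le_of_norm_le_const (C := 1) fun v _ => ?_).trans ?_
      · rw [norm_exp, show -(3 * I * (v : ℂ) ^ 2) = ((-(3 * v ^ 2) : ℝ) : ℂ) * I by push_cast; ring]
        rw [re_ofReal_mul, I_re, mul_zero, Real.exp_zero]
      · rw [abs_of_nonneg (by linarith)]
        linarith
    have h2 := fresnel_sub_le one_pos
    calc ‖fresnelLimit - fresnel y‖ = ‖(fresnelLimit - fresnel 1) + (fresnel 1 - fresnel y)‖ := by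
          congr 1; ring
      _ ≤ 2 / 1 + 1 := (norm_add_le _ _).trans (add_le_add h2 h1)
      _ ≤ 4 := by norm_num

/-! ### Oscillatory estimates, uniform in the truncation. -/

/-- Integration by parts in the form of a bound: `f` is a derivative `F'` up to `O(u⁻²)`. -/
lemma norm_integral_le_of_near_deriv {f F F' : ℝ → ℂ} {K a b : ℝ} (ha : 0 < a) (hab : a ≤ b)
    (hK : 0 ≤ K) (hf : Continuous f) (hF : ∀ u ∈ Icc a b, HasDerivAt F (F' u) u)
    (hFb : ∀ u ∈ Icc a b, ‖F u‖ ≤ K / u) (hb : ∀ u ∈ Icc a b, ‖f u - F' u‖ ≤ K / u ^ 2) :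
    ‖∫ u in a..b, f u‖ ≤ 3 * K / a := by
  -- `Φ` is the error of the approximate primitive `F`; its derivative is at most K/x², the
  -- derivative of K/a - K/x, so the mean value inequality applies.
  set Φ : ℝ → ℂ := fun x => (∫ u in a..x, f u) - (F x - F a) with hΦ
  have hd : ∀ x ∈ Icc a b, HasDerivAt Φ (f x - F' x) x := fun x hx =>
    (intervalIntegral.integral_hasDerivAt_right (hf.intervalIntegrable _ _)
      (hf.stronglyMeasurableAtFilter _ _) hf.continuousAt).sub ((hF x hx).sub_const _)
  have hB : ∀ x ∈ Icc a b, HasDerivAt (fun x => K / a - K / x) (K / x ^ 2) x := by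
    intro x hx
    have hx0 : x ≠ 0 := (ha.trans_le hx.1).ne'
    have := ((hasDerivAt_inv hx0).const_mul K).const_sub (K / a)
    simp only [← div_eq_mul_inv] at this
    refine this.congr_deriv ?_
    ring
  have h := image_norm_le_of_norm_deriv_right_le_deriv_boundary' (f := Φ)
    (f' := fun x => f x - F' x) (a := a) (b := b)
    (fun x hx => (hd x hx).continuousAt.continuousWithinAt)
    (fun x hx => (hd x ⟨hx.1, hx.2.le⟩).hasDerivWithinAt)
    (B := fun x => K / a - K / x) (B' := fun x => K / x ^ 2) (by simp [hΦ])
    (fun x hx => (hB x hx).continuousAt.continuousWithinAt)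
    (fun x hx => (hB x ⟨hx.1, hx.2.le⟩).hasDerivWithinAt)
    (fun x hx => hb x ⟨hx.1, hx.2.le⟩) (x := b) ⟨hab, le_rfl⟩
  have h1 := hFb a ⟨le_rfl, hab⟩
  have h2 := hFb b ⟨hab, le_rfl⟩
  have h3 : K / b ≤ K / a := by gcongr
  have e : ∫ u in a..b, f u = Φ b + (F b - F a) := by simp [hΦ]
  rw [e]
  calc ‖Φ b + (F b - F a)‖ ≤ (K / a - K / b) + (K / b + K / a) :=
        (norm_add_le _ _).trans (add_le_add h ((norm_sub_le _ _).trans (add_le_add h2 h1)))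
    _ ≤ 3 * K / a := by
      have : 0 ≤ K / a := by positivity
      rw [mul_div_assoc]
      linarith

/-- The oscillating factor `exp(i(u⁶ + pu⁴ + qu²))`. -/
noncomputable def sexticWave (p q : ℝ) (u : ℂ) : ℂ := exp (I * (u ^ 6 + p * u ^ 4 + q * u ^ 2))

@[fun_prop]
lemma differentiable_sexticWave (p q : ℝ) : Differentiable ℂ (sexticWave p q) := by
  unfold sexticWave
  fun_prop

@[fun_prop]
lemma continuous_sexticWave (p q : ℝ) : Continuous (sexticWave p q) :=
  (differentiable_sexticWave p q).continuous

lemma norm_sexticWave (p q u : ℝ) : ‖sexticWave p q u‖ = 1 := by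
  rw [sexticWave, show I * ((u : ℂ) ^ 6 + p * (u : ℂ) ^ 4 + q * (u : ℂ) ^ 2) =
    ((u ^ 6 + p * u ^ 4 + q * u ^ 2 : ℝ) : ℂ) * I by push_cast; ring, norm_exp_ofReal_mul_I]

lemma hasDerivAt_sexticWave (p q u : ℝ) :
    HasDerivAt (fun u : ℝ => sexticWave p q u)
      (sexticWave p q u * (I * ((6 * u ^ 5 + 4 * p * u ^ 3 + 2 * q * u : ℝ) : ℂ))) u := by
  have h : HasDerivAt (sexticWave p q)
      (sexticWave p q u * (I * (6 * u ^ 5 + p * (4 * u ^ 3) + q * (2 * u)))) (u : ℂ) := by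
    unfold sexticWave
    have := (((hasDerivAt_pow 6 (u : ℂ)).add ((hasDerivAt_pow 4 (u : ℂ)).const_mul (p : ℂ))).add
      ((hasDerivAt_pow 2 (u : ℂ)).const_mul (q : ℂ))).const_mul I
    refine this.cexp.congr_deriv ?_
    simp
  refine h.comp_ofReal.congr_deriv ?_
  push_cast
  ring

lemma hasDerivAt_fresnel_mul (b u : ℝ) :
    HasDerivAt (fun u : ℝ => fresnelLimit - fresnel (b * u))
      (-(b * exp (-(3 * I * ((b * u : ℝ) : ℂ) ^ 2)))) u := by
  have h := (hasDerivAt_fresnel (b * u)).scomp u ((hasDerivAt_id u).const_mul b)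
  refine (h.const_sub fresnelLimit).congr_deriv ?_
  simp

/-- Far from the origin the oscillation of the phase dominates, uniformly in the truncation. -/
lemma exists_norm_tail_le (p q : ℝ) : ∃ K U : ℝ, 0 < K ∧ 1 ≤ U ∧ ∀ b u₁ u₂ : ℝ, 1 ≤ b → U ≤ u₁ →
    4 * b ≤ u₁ ^ 2 → u₁ ≤ u₂ →
    ‖∫ u in u₁..u₂, sexticWave p q u * (fresnelLimit - fresnel (b * u))‖ ≤ K / u₁ := by
  set N : ℝ := 36 + 12 * |p| + 2 * |q| with hN
  have hp := abs_nonneg p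
  have hq := abs_nonneg q
  have hN0 : 0 < N := by positivity
  -- The factor 3 comes from `norm_integral_le_of_near_deriv`; 13 = 12 + 1 and 2N bound the error
  -- terms `n1`, `n2` and `n3` below. The lower bound on u gives 4|p| + 2|q| ≤ u².
  refine ⟨3 * (13 + 2 * N), 1 + 4 * |p| + 2 * |q|, by positivity, by linarith, ?_⟩
  intro b u₁ u₂ hb hU hbu h12
  have hu1 : 1 ≤ u₁ := by linarith
  -- `g` is the derivative of the phase u⁶ + pu⁴ + qu² - 3b²u², where -3b²u² is the oscillation
  -- carried by the Fresnel remainder. It can be stationary only for u² of order b, so 4b ≤ u² keeps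
  -- g ≥ u⁵.
  set g : ℝ → ℝ := fun u => 6 * u ^ 5 + 4 * p * u ^ 3 + 2 * q * u - 6 * b ^ 2 * u with hg
  set g' : ℝ → ℝ := fun u => 30 * u ^ 4 + 12 * p * u ^ 2 + 2 * q - 6 * b ^ 2 with hg'
  have hgd : ∀ u, HasDerivAt g (g' u) u := by
    intro u
    have := ((((hasDerivAt_pow 5 u).const_mul 6).add ((hasDerivAt_pow 3 u).const_mul (4 * p))).add
      ((hasDerivAt_id u).const_mul (2 * q))).sub ((hasDerivAt_id u).const_mul (6 * b ^ 2))
    refine this.congr_deriv ?_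
    simp only [hg']
    push_cast
    ring
  have hub : ∀ u ∈ Icc u₁ u₂, 1 ≤ u ∧ 4 * b ≤ u ^ 2 ∧ 1 + 4 * |p| + 2 * |q| ≤ u := by
    intro u hu
    refine ⟨hu1.trans hu.1, hbu.trans ?_, hU.trans hu.1⟩
    have := hu.1
    gcongr
  have hgl : ∀ u ∈ Icc u₁ u₂, u ^ 5 ≤ g u := by
    intro u hu
    obtain ⟨h1, h2, h3⟩ := hub u hu
    have hu0 : 0 < u := by linarith
    have hp1 : -|p| * u ^ 3 ≤ p * u ^ 3 := by
      have := neg_abs_le p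
      gcongr
    have hq1 : -|q| * u ≤ q * u := by
      have := neg_abs_le q
      gcongr
    have hq2 : |q| * u ≤ |q| * u ^ 3 := by
      have : u ≤ u ^ 3 := le_self_pow₀ h1 (by norm_num)
      gcongr
    have h4 : (4 * |p| + 2 * |q|) * u ^ 3 ≤ u ^ 2 * u ^ 3 := by
      have : 4 * |p| + 2 * |q| ≤ u ^ 2 := by nlinarith
      gcongr
    have h5 : (4 * b) ^ 2 * u ≤ (u ^ 2) ^ 2 * u := by gcongr
    simp only [hg]
    nlinarith
  have hg'l : ∀ u ∈ Icc u₁ u₂, |g' u| ≤ N * u ^ 4 := by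
    intro u hu
    obtain ⟨h1, h2, h3⟩ := hub u hu
    have e1 : u ^ 2 ≤ u ^ 4 := pow_le_pow_right₀ h1 (by norm_num)
    have e2 : 1 ≤ u ^ 4 := one_le_pow₀ h1
    have e3 : (4 * b) ^ 2 ≤ (u ^ 2) ^ 2 := by gcongr
    have hpu : |p * u ^ 2| ≤ |p| * u ^ 4 := by
      rw [abs_mul, abs_of_nonneg (sq_nonneg u)]
      gcongr
    have hqu : |q| ≤ |q| * u ^ 4 := le_mul_of_one_le_right hq e2
    have a1 := abs_le.1 hpu
    have a2 := abs_le.1 (le_refl |q|)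
    rw [abs_le]
    simp only [hg', hN]
    constructor <;> nlinarith
  set R : ℝ → ℂ := fun u => fresnelLimit - fresnel (b * u) with hR
  have hRb : ∀ u ∈ Icc u₁ u₂, ‖R u‖ ≤ 2 / (b * u) := by
    intro u hu
    obtain ⟨h1, h2, h3⟩ := hub u hu
    exact fresnel_sub_le (by positivity)
  have hRc : Continuous R := by
    have := continuous_fresnel
    fun_prop
  -- The approximate primitive is the integrand over i`g`. Its derivative misses the integrand by
  -- three terms: the part 6b²u subtracted in `g`, the derivative of the Fresnel remainder, and the
  -- derivative of 1/`g`.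
  have hdF : ∀ u ∈ Icc u₁ u₂, HasDerivAt (fun u : ℝ => sexticWave p q u * R u / (I * (g u : ℂ)))
      (sexticWave p q u * R u + (sexticWave p q u * R u * (6 * b ^ 2 * u / g u)
        - sexticWave p q u * (b * exp (-(3 * I * ((b * u : ℝ) : ℂ) ^ 2)) / (I * g u))
        - sexticWave p q u * R u * (g' u / (I * g u ^ 2)))) u := by
    intro u hu
    have hg0 : 0 < g u := lt_of_lt_of_le (pow_pos (by linarith [(hub u hu).1]) 5) (hgl u hu)
    have hgc : (g u : ℂ) ≠ 0 := ofReal_ne_zero.2 hg0.ne'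
    have h := ((hasDerivAt_sexticWave p q u).mul (hasDerivAt_fresnel_mul b u)).div
      (((hgd u).ofReal_comp).const_mul I) (mul_ne_zero I_ne_zero hgc)
    refine h.congr_deriv ?_
    have e : ((6 * u ^ 5 + 4 * p * u ^ 3 + 2 * q * u : ℝ) : ℂ) = (g u : ℂ) + 6 * b ^ 2 * u := by
      simp only [hg]
      push_cast
      ring
    rw [e]
    simp only [hR, Pi.mul_apply]
    field_simp [I_ne_zero]
    ring
  have key := norm_integral_le_of_near_deriv (K := 13 + 2 * N) (by linarith) h12 (by positivity)
    (f := fun u : ℝ => sexticWave p q u * R u) (by fun_prop) hdF ?_ ?_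
  · simpa [mul_div_assoc] using key
  · intro u hu
    obtain ⟨h1, h2, h3⟩ := hub u hu
    have hg0 : 1 ≤ g u := (one_le_pow₀ h1).trans (hgl u hu)
    have hu0 : 0 < u := by linarith
    rw [norm_div, norm_mul, norm_sexticWave, one_mul, norm_mul, norm_I, one_mul, norm_real,
      Real.norm_of_nonneg (by linarith)]
    calc ‖R u‖ / g u ≤ ‖R u‖ := div_le_self (norm_nonneg _) hg0
      _ ≤ 2 / (b * u) := hRb u hu
      _ ≤ 2 / u := by
        gcongr
        exact le_mul_of_one_le_left hu0.le hb
      _ ≤ (13 + 2 * N) / u := by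
        gcongr
        linarith
  · intro u hu
    obtain ⟨h1, h2, h3⟩ := hub u hu
    have hu0 : 0 < u := by linarith
    have hgu := hgl u hu
    have hg0 : 0 < g u := (pow_pos hu0 5).trans_le hgu
    have hR1 := hRb u hu
    have hb0 : 0 < b := by linarith
    rw [← norm_neg]
    have n1 : ‖sexticWave p q u * R u * (6 * b ^ 2 * u / g u)‖ ≤ 12 / u ^ 2 := by
      rw [norm_mul, norm_mul, norm_sexticWave, one_mul,
        show (6 * (b : ℂ) ^ 2 * u / g u) = ((6 * b ^ 2 * u / g u : ℝ) : ℂ) by push_cast; ring,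
        norm_real, Real.norm_of_nonneg (by positivity)]
      calc ‖R u‖ * (6 * b ^ 2 * u / g u) ≤ 2 / (b * u) * (6 * b ^ 2 * u / u ^ 5) := by gcongr
        _ = 12 * b / u ^ 5 := by field_simp; ring
        _ ≤ 12 * u ^ 3 / u ^ 5 := by
          gcongr
          nlinarith [mul_nonneg (sq_nonneg u) (sub_nonneg.2 h1)]
        _ = 12 / u ^ 2 := by field_simp
    have n2 : ‖sexticWave p q u * (b * exp (-(3 * I * ((b * u : ℝ) : ℂ) ^ 2)) / (I * g u))‖ ≤
        1 / u ^ 2 := by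
      rw [norm_mul, norm_sexticWave, one_mul, norm_div, norm_mul, norm_mul, norm_I, one_mul,
        norm_exp, show -(3 * I * ((b * u : ℝ) : ℂ) ^ 2) = ((-(3 * (b * u) ^ 2) : ℝ) : ℂ) * I by
          push_cast; ring, re_ofReal_mul, I_re, mul_zero, Real.exp_zero, mul_one, norm_real,
        norm_real, Real.norm_of_nonneg hb0.le, Real.norm_of_nonneg hg0.le]
      calc b / g u ≤ u ^ 3 / u ^ 5 := by
            gcongr
            nlinarith [mul_nonneg (sq_nonneg u) (sub_nonneg.2 h1)]
        _ = 1 / u ^ 2 := by field_simp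
    have n3 : ‖sexticWave p q u * R u * (g' u / (I * g u ^ 2))‖ ≤ 2 * N / u ^ 2 := by
      rw [norm_mul, norm_mul, norm_sexticWave, one_mul, norm_div, norm_mul, norm_I, one_mul,
        norm_pow, norm_real, norm_real, Real.norm_of_nonneg hg0.le, Real.norm_eq_abs]
      calc ‖R u‖ * (|g' u| / g u ^ 2) ≤ 2 / (b * u) * (N * u ^ 4 / (u ^ 5) ^ 2) := by
            have := hg'l u hu
            gcongr
        _ ≤ 2 / (1 * 1) * (N * u ^ 4 / (u ^ 5) ^ 2) := by gcongr
        _ = 2 * N / u ^ 2 * (1 / u ^ 4) := by field_simp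
        _ ≤ 2 * N / u ^ 2 * 1 := by
          gcongr
          rw [div_le_one (by positivity)]
          exact one_le_pow₀ h1
        _ = 2 * N / u ^ 2 := mul_one _
    have e : -(sexticWave p q u * R u - (sexticWave p q u * R u +
        (sexticWave p q u * R u * (6 * b ^ 2 * u / g u)
        - sexticWave p q u * (b * exp (-(3 * I * ((b * u : ℝ) : ℂ) ^ 2)) / (I * g u))
        - sexticWave p q u * R u * (g' u / (I * g u ^ 2))))) =
        sexticWave p q u * R u * (6 * b ^ 2 * u / g u)
        - sexticWave p q u * (b * exp (-(3 * I * ((b * u : ℝ) : ℂ) ^ 2)) / (I * g u))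
        - sexticWave p q u * R u * (g' u / (I * g u ^ 2)) := by ring
    rw [e]
    calc _ ≤ 12 / u ^ 2 + 1 / u ^ 2 + 2 * N / u ^ 2 :=
          (norm_sub_le _ _).trans (add_le_add ((norm_sub_le _ _).trans (add_le_add n1 n2)) n3)
      _ = (13 + 2 * N) / u ^ 2 := by ring

/-- Replacing the truncated Fresnel integral by its limit costs little, uniformly in `B`. -/
lemma exists_norm_fresnel_error_le (p q : ℝ) : ∃ K A : ℝ, 0 < K ∧ 1 ≤ A ∧ ∀ a B : ℝ, A ≤ a →
    0 ≤ B → ‖∫ u in (0 : ℝ)..B, sexticWave p q u * (fresnelLimit - fresnel (a ^ 4 * u))‖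
      ≤ K / a := by
  obtain ⟨K, U₀, hK, hU₀, hT⟩ := exists_norm_tail_le p q
  refine ⟨8 + K, U₀, by positivity, hU₀, fun a B ha hB => ?_⟩
  have ha1 : 1 ≤ a := hU₀.trans ha
  have ha0 : 0 < a := by linarith
  set f : ℝ → ℂ := fun u => sexticWave p q u * (fresnelLimit - fresnel (a ^ 4 * u)) with hf
  have hfc : Continuous f := by
    have := continuous_fresnel
    fun_prop
  have hn : ∀ u, ‖f u‖ = ‖fresnelLimit - fresnel (a ^ 4 * u)‖ := fun u => by
    simp only [hf, norm_mul, norm_sexticWave, one_mul]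
  have hi : ∀ x y, IntervalIntegrable f volume x y := fun x y => hfc.intervalIntegrable x y
  -- The cuts are at 1/a and 2a². Below 1/a the remainder is bounded; between the cuts it is at most
  -- 2/a³ on a length of at most 2a²; beyond, (2a²)² = 4a⁴ is the threshold of the tail estimate
  -- with b = a⁴. The minima with `B` cover a short interval.
  set x := min B (1 / a) with hx
  set y := min B (2 * a ^ 2) with hy
  have hda : 1 / a ≤ 2 * a ^ 2 := by
    rw [div_le_iff₀ ha0]
    nlinarith [one_le_pow₀ ha1 (n := 3)]
  have hx0 : 0 ≤ x := le_min hB (by positivity)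
  have hxy : x ≤ y := min_le_min le_rfl hda
  have i1 : ‖∫ u in (0 : ℝ)..x, f u‖ ≤ 4 / a := by
    refine (intervalIntegral.norm_integral_le_of_norm_le_const (C := 4) fun u hu => ?_).trans ?_
    · rw [uIoc_of_le hx0] at hu
      rw [hn]
      exact fresnel_sub_bounded (mul_nonneg (by positivity) hu.1.le)
    · rw [sub_zero, abs_of_nonneg hx0, div_eq_mul_one_div]
      have : x ≤ 1 / a := min_le_right _ _
      linarith
  have i2 : ‖∫ u in x..y, f u‖ ≤ 4 / a := by
    rcases le_total B (1 / a) with h | h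
    · have : x = y := by rw [hx, hy, min_eq_left h, min_eq_left (h.trans hda)]
      rw [this, intervalIntegral.integral_same, norm_zero]
      positivity
    · have hxa : x = 1 / a := min_eq_right h
      refine (intervalIntegral.norm_integral_le_of_norm_le_const (C := 2 / a ^ 3)
        fun u hu => ?_).trans ?_
      · rw [uIoc_of_le hxy, hxa] at hu
        have hu0 : 0 < u := lt_trans (by positivity) hu.1
        rw [hn]
        refine (fresnel_sub_le (by positivity)).trans ?_
        have h1 : 1 < u * a := (div_lt_iff₀ ha0).1 hu.1
        gcongr
        calc a ^ 3 = a ^ 3 * 1 := (mul_one _).symm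
          _ ≤ a ^ 3 * (u * a) := by gcongr
          _ = a ^ 4 * u := by ring
      · rw [abs_of_nonneg (by linarith)]
        have : y - x ≤ 2 * a ^ 2 := by linarith [min_le_right B (2 * a ^ 2)]
        calc 2 / a ^ 3 * (y - x) ≤ 2 / a ^ 3 * (2 * a ^ 2) := by gcongr
          _ = 4 / a := by field_simp; norm_num
  have i3 : ‖∫ u in y..B, f u‖ ≤ K / a := by
    rcases le_total B (2 * a ^ 2) with h | h
    · rw [hy, min_eq_left h, intervalIntegral.integral_same, norm_zero]
      positivity
    · rw [hy, min_eq_right h]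
      have ha2 : a ≤ 2 * a ^ 2 := by nlinarith
      refine (hT (a ^ 4) (2 * a ^ 2) B (one_le_pow₀ ha1) (ha.trans ha2) (by ring_nf; rfl) h).trans ?_
      gcongr
  have e : ∫ u in (0 : ℝ)..B, f u =
      (∫ u in (0 : ℝ)..x, f u) + (∫ u in x..y, f u) + ∫ u in y..B, f u := by
    rw [intervalIntegral.integral_add_adjacent_intervals (hi _ _) (hi _ _),
      intervalIntegral.integral_add_adjacent_intervals (hi _ _) (hi _ _)]
  rw [e]
  calc _ ≤ 4 / a + 4 / a + K / a :=
        (norm_add_le _ _).trans (add_le_add ((norm_add_le _ _).trans (add_le_add i1 i2)) i3)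
    _ = (8 + K) / a := by ring

/-! ### The sextic exponential integral on the ray of steepest descent. -/

lemma integrableOn_exp_neg_sextic (A B D : ℝ) :
    IntegrableOn (fun s : ℝ => Real.exp (-s ^ 6 + A * s ^ 4 + B * s ^ 2 + D)) (Ioi 0) := by
  refine integrable_of_isBigO_exp_neg (b := 1) one_pos (by fun_prop) ?_
  refine Asymptotics.IsBigO.of_bound (Real.exp D) ?_
  filter_upwards [eventually_ge_atTop (1 + |A| + |B|)] with s hs
  have hA := abs_nonneg A
  have hB := abs_nonneg B
  have h1 : 1 ≤ s := by linarith
  rw [Real.norm_of_nonneg (Real.exp_pos _).le, Real.norm_of_nonneg (Real.exp_pos _).le,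
    ← Real.exp_add, Real.exp_le_exp]
  have e4 : s ≤ s ^ 4 := le_self_pow₀ h1 (by norm_num)
  have e2 : s ^ 2 ≤ s ^ 4 := pow_le_pow_right₀ h1 (by norm_num)
  have e1 : s ^ 5 ≤ s ^ 6 := pow_le_pow_right₀ h1 (by norm_num)
  have h4 : (1 + |A| + |B|) * s ^ 4 ≤ s * s ^ 4 := by gcongr
  have a1 : A * s ^ 4 ≤ |A| * s ^ 4 := by
    have := le_abs_self A
    gcongr
  have a2 : B * s ^ 2 ≤ |B| * s ^ 4 := by
    have := le_abs_self B
    gcongr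
  nlinarith

/-- `exp(πi/6)`, a cube root of `i`. -/
noncomputable def sexticUnit : ℂ := exp ((Real.pi / 6 : ℝ) * I)

lemma sexticUnit_pow_three : sexticUnit ^ 3 = I := by
  rw [sexticUnit, ← Complex.exp_nat_mul]
  conv_rhs => rw [← exp_pi_div_two_mul_I]
  congr 1
  push_cast
  ring

lemma norm_sexticUnit : ‖sexticUnit‖ = 1 := norm_exp_ofReal_mul_I _

lemma sexticUnit_ne_zero : sexticUnit ≠ 0 := exp_ne_zero _

/-- The sextic exponential integral along the rotated ray of steepest descent. -/
noncomputable def rayIntegral (p q : ℝ) : ℂ :=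
  ∫ s in Ioi (0 : ℝ), exp (-(s : ℂ) ^ 6 + I * p * sexticUnit ^ 2 * (s : ℂ) ^ 4
    + I * q * sexticUnit * (s : ℂ) ^ 2)

lemma integrableOn_ray (p q : ℝ) : IntegrableOn (fun s : ℝ => exp (-(s : ℂ) ^ 6 +
    I * p * sexticUnit ^ 2 * (s : ℂ) ^ 4 + I * q * sexticUnit * (s : ℂ) ^ 2)) (Ioi 0) := by
  refine (integrableOn_exp_neg_sextic |p| |q| 0).mono'
    (Continuous.aestronglyMeasurable (by fun_prop)) (ae_of_all _ fun s => ?_)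
  rw [norm_exp, Real.exp_le_exp, add_re, add_re, add_zero]
  have h1 : (-(s : ℂ) ^ 6).re = -s ^ 6 := by
    rw [← ofReal_pow, ← ofReal_neg, ofReal_re]
  have h2 : (I * p * sexticUnit ^ 2 * (s : ℂ) ^ 4).re ≤ |p| * s ^ 4 := by
    refine (re_le_norm _).trans_eq ?_
    rw [norm_mul, norm_mul, norm_mul, norm_I, norm_real, norm_pow, norm_sexticUnit, norm_pow,
      norm_real, one_mul, one_pow, mul_one, Real.norm_eq_abs, Real.norm_eq_abs,
      (show Even 4 by decide).pow_abs]
  have h3 : (I * q * sexticUnit * (s : ℂ) ^ 2).re ≤ |q| * s ^ 2 := by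
    refine (re_le_norm _).trans_eq ?_
    rw [norm_mul, norm_mul, norm_mul, norm_I, norm_real, norm_sexticUnit, norm_pow,
      norm_real, one_mul, mul_one, Real.norm_eq_abs, Real.norm_eq_abs,
      (show Even 2 by decide).pow_abs]
  rw [h1]
  linarith

/-- At angle π/12 the term iu⁶ becomes -s⁶. On the arc of radius V, sin 6θ ≥ 3θ gives decay 3V⁶θ, of
which the lower powers consume at most 2V⁶θ for large V. The arc therefore costs at most V/V⁶. -/
lemma tendsto_integral_sexticWave (p q : ℝ) :
    Tendsto (fun V : ℝ => ∫ u in (0 : ℝ)..V, sexticWave p q u) atTop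
      (𝓝 (exp ((Real.pi / 12 : ℝ) * I) * rayIntegral p q)) := by
  have hsq : exp ((Real.pi / 12 : ℝ) * I) ^ 2 = sexticUnit := by
    rw [sexticUnit, ← Complex.exp_nat_mul]
    congr 1
    push_cast
    ring
  have hrot : ∀ s : ℝ, sexticWave p q (exp ((Real.pi / 12 : ℝ) * I) * s) =
      exp (-(s : ℂ) ^ 6 + I * p * sexticUnit ^ 2 * (s : ℂ) ^ 4
        + I * q * sexticUnit * (s : ℂ) ^ 2) := by
    intro s
    rw [sexticWave]
    congr 1
    have e6 : exp ((Real.pi / 12 : ℝ) * I) ^ 6 = I := by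
      rw [show (6 : ℕ) = 2 * 3 from rfl, pow_mul, hsq, sexticUnit_pow_three]
    have e4 : exp ((Real.pi / 12 : ℝ) * I) ^ 4 = sexticUnit ^ 2 := by
      rw [show (4 : ℕ) = 2 * 2 from rfl, pow_mul, hsq]
    rw [mul_pow, mul_pow, mul_pow, e6, e4, hsq]
    linear_combination (s : ℂ) ^ 6 * I_sq
  have hlim : Tendsto (fun V : ℝ => exp ((Real.pi / 12 : ℝ) * I) *
      ∫ s in (0 : ℝ)..V, sexticWave p q (exp ((Real.pi / 12 : ℝ) * I) * s)) atTop
      (𝓝 (exp ((Real.pi / 12 : ℝ) * I) * rayIntegral p q)) := by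
    simp only [hrot]
    exact (intervalIntegral_tendsto_integral_Ioi 0 (integrableOn_ray p q) tendsto_id).const_mul _
  refine tendsto_of_tendsto_of_dist hlim ?_
  have hz : Tendsto (fun V : ℝ => V / V ^ 6) atTop (𝓝 0) := by
    have : Tendsto (fun V : ℝ => (V ^ 5)⁻¹) atTop (𝓝 0) :=
      tendsto_inv_atTop_zero.comp (tendsto_pow_atTop (by norm_num))
    refine this.congr' ?_
    filter_upwards [eventually_gt_atTop 0] with V hV
    field_simp
  refine squeeze_zero' (Eventually.of_forall fun _ => dist_nonneg) ?_ hz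
  filter_upwards [eventually_ge_atTop (1 + 2 * |p| + |q|)] with V hV
  have hp := abs_nonneg p
  have hq := abs_nonneg q
  have hV1 : 1 ≤ V := by linarith
  rw [dist_comm, dist_eq_norm]
  refine norm_integral_sub_rotated_le (differentiable_sexticWave p q) (by linarith)
    (by positivity) (by positivity) fun θ hθ => ?_
  rw [sexticWave, norm_exp, Real.exp_le_exp]
  have e : I * ((V * exp (θ * I)) ^ 6 + p * (V * exp (θ * I)) ^ 4 + q * (V * exp (θ * I)) ^ 2) =
      ((V ^ 6 : ℝ) : ℂ) * (I * exp ((6 * θ : ℝ) * I)) +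
      ((p * V ^ 4 : ℝ) : ℂ) * (I * exp ((4 * θ : ℝ) * I)) +
      ((q * V ^ 2 : ℝ) : ℂ) * (I * exp ((2 * θ : ℝ) * I)) := by
    simp only [mul_pow, ← Complex.exp_nat_mul]
    push_cast
    ring_nf
  rw [e]
  simp only [add_re, re_ofReal_mul, I_mul_re, exp_ofReal_mul_I_im]
  have hpi : Real.pi ≤ 4 := Real.pi_le_four
  have h0 := hθ.1
  have s6 : 3 * θ ≤ Real.sin (6 * θ) := by
    refine le_trans ?_ (Real.mul_le_sin (by linarith) (by linarith [hθ.2]))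
    rw [div_mul_eq_mul_div, le_div_iff₀ Real.pi_pos]
    nlinarith
  have s4 : -(p * V ^ 4 * Real.sin (4 * θ)) ≤ |p| * V ^ 4 * (4 * θ) := by
    refine (neg_le_abs _).trans ?_
    rw [abs_mul, abs_mul, abs_of_nonneg (by positivity : 0 ≤ V ^ 4)]
    have := (Real.abs_sin_le_abs (x := 4 * θ))
    rw [abs_of_nonneg (by positivity : 0 ≤ 4 * θ)] at this
    gcongr
  have s2 : -(q * V ^ 2 * Real.sin (2 * θ)) ≤ |q| * V ^ 2 * (2 * θ) := by
    refine (neg_le_abs _).trans ?_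
    rw [abs_mul, abs_mul, abs_of_nonneg (by positivity : 0 ≤ V ^ 2)]
    have := (Real.abs_sin_le_abs (x := 2 * θ))
    rw [abs_of_nonneg (by positivity : 0 ≤ 2 * θ)] at this
    gcongr
  have hV2 : 2 * |p| + |q| ≤ V ^ 2 := by nlinarith
  have h24 : V ^ 2 ≤ V ^ 4 := pow_le_pow_right₀ hV1 (by norm_num)
  have t1 : V ^ 6 * (3 * θ) ≤ V ^ 6 * Real.sin (6 * θ) := by gcongr
  have t2 : (2 * |p| + |q|) * V ^ 4 * (2 * θ) ≤ V ^ 2 * V ^ 4 * (2 * θ) := by gcongr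
  have t3 : |q| * V ^ 2 * (2 * θ) ≤ |q| * V ^ 4 * (2 * θ) := by gcongr
  nlinarith

/-! ### Reduction of the double integral to ray integrals. -/

/-- One quarter of the truncated umbilic integral, in the coordinate `t = ξ + z/3`. -/
noncomputable def quarterIntegral (p q β b : ℝ) : ℂ :=
  ∫ t in (0 : ℝ)..β, exp (I * ((t : ℂ) ^ 3 + p * (t : ℂ) ^ 2 + q * t)) *
    ∫ η in (0 : ℝ)..b, exp (-(3 * I * t * (η : ℂ) ^ 2))

/-- With t = u² the inner integral rescales to `fresnel (b * u)` divided by u, and the Jacobian 2u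
cancels that singularity. -/
lemma quarterIntegral_eq (p q b : ℝ) {β : ℝ} (hβ : 0 ≤ β) :
    quarterIntegral p q β b =
      2 * ∫ u in (0 : ℝ)..Real.sqrt β, sexticWave p q u * fresnel (b * u) := by
  set g : ℝ → ℂ := fun t => exp (I * ((t : ℂ) ^ 3 + p * (t : ℂ) ^ 2 + q * t)) *
    ∫ η in (0 : ℝ)..b, exp (-(3 * I * t * (η : ℂ) ^ 2)) with hg
  have hgc : Continuous g := by
    refine Continuous.mul (by fun_prop) ?_
    exact intervalIntegral.continuous_parametric_intervalIntegral_of_continuous'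
      (by unfold Function.uncurry; fun_prop) _ _
  have hs := intervalIntegral.integral_deriv_smul_comp (a := 0) (b := Real.sqrt β)
    (f := fun u : ℝ => u ^ 2) (f' := fun u => 2 * u) (g := g)
    (fun u _ => (hasDerivAt_pow 2 u).congr_deriv (by norm_num)) (by fun_prop) hgc
  simp only [Real.sq_sqrt hβ, ne_eq, OfNat.ofNat_ne_zero, not_false_eq_true, zero_pow] at hs
  rw [quarterIntegral, ← hs, ← intervalIntegral.integral_const_mul]
  congr 1
  ext u
  have hF : fresnel (b * u) = (u : ℂ) * ∫ η in (0 : ℝ)..b, exp (-(3 * I * (u ^ 2 : ℝ) * (η : ℂ) ^ 2)) := by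
    have := intervalIntegral.smul_integral_comp_mul_left (a := 0) (b := b)
      (fun v : ℝ => exp (-(3 * I * (v : ℂ) ^ 2))) u
    rw [mul_zero, mul_comm u b] at this
    rw [fresnel, ← this, real_smul]
    congr 2
    ext η
    push_cast
    ring_nf
  rw [hF, Function.comp_apply, hg, real_smul, sexticWave]
  push_cast
  ring_nf

/-- Once the Fresnel factor is replaced by its limit only the t-truncation remains. The error is
O(b^(-1/4)) uniformly in β, which allows both sides to grow independently. -/
lemma tendsto_quarterIntegral (p q : ℝ) :
    Tendsto (fun x : ℝ × ℝ => quarterIntegral p q x.1 x.2) (atTop ×ˢ atTop)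
      (𝓝 (((Real.sqrt Real.pi / Real.sqrt 3 : ℝ) : ℂ) * sexticUnit⁻¹ * rayIntegral p q)) := by
  have hval : ((Real.sqrt Real.pi / Real.sqrt 3 : ℝ) : ℂ) * sexticUnit⁻¹ * rayIntegral p q =
      2 * (exp ((Real.pi / 12 : ℝ) * I) * rayIntegral p q * fresnelLimit) := by
    have : sexticUnit⁻¹ = exp ((Real.pi / 12 : ℝ) * I) * exp (-(Real.pi / 4 * I)) := by
      rw [sexticUnit, ← exp_neg, ← exp_add]
      congr 1
      push_cast
      ring
    rw [this, fresnelLimit, Real.sqrt_div Real.pi_pos.le]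
    push_cast
    ring
  rw [hval]
  have hroot : Tendsto (fun x : ℝ × ℝ => Real.sqrt x.1) (atTop ×ˢ atTop) atTop :=
    Real.tendsto_sqrt_atTop.comp tendsto_fst
  have hmain := (((tendsto_integral_sexticWave p q).comp hroot).mul_const fresnelLimit).const_mul 2
  refine tendsto_of_tendsto_of_dist hmain ?_
  obtain ⟨K, A, hK, hA, hE⟩ := exists_norm_fresnel_error_le p q
  have hz : Tendsto (fun x : ℝ × ℝ => 2 * (K / Real.sqrt (Real.sqrt x.2))) (atTop ×ˢ atTop) (𝓝 0) := by
    have h1 : Tendsto (fun x : ℝ × ℝ => Real.sqrt (Real.sqrt x.2)) (atTop ×ˢ atTop) atTop :=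
      Real.tendsto_sqrt_atTop.comp (Real.tendsto_sqrt_atTop.comp tendsto_snd)
    simpa using (h1.const_div_atTop K).const_mul 2
  refine squeeze_zero' (Eventually.of_forall fun _ => dist_nonneg) ?_ hz
  have ev1 : ∀ᶠ x : ℝ × ℝ in atTop ×ˢ atTop, 0 ≤ x.1 := tendsto_fst.eventually_ge_atTop 0
  have ev2 : ∀ᶠ x : ℝ × ℝ in atTop ×ˢ atTop, (A ^ 2) ^ 2 ≤ x.2 :=
    tendsto_snd.eventually_ge_atTop _
  filter_upwards [ev1, ev2] with x hx1 hx2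
  have hx20 : 0 ≤ x.2 := le_trans (by positivity) hx2
  have ha4 : Real.sqrt (Real.sqrt x.2) ^ 4 = x.2 := by
    rw [show (4 : ℕ) = 2 * 2 from rfl, pow_mul, Real.sq_sqrt (Real.sqrt_nonneg _), Real.sq_sqrt hx20]
  -- The uniform estimate is stated for b = a⁴, so a is the fourth root of the η-side.
  have h := hE (Real.sqrt (Real.sqrt x.2)) (Real.sqrt x.1)
    (Real.le_sqrt_of_sq_le (Real.le_sqrt_of_sq_le hx2)) (Real.sqrt_nonneg _)
  rw [ha4] at h
  have hc := continuous_fresnel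
  rw [dist_eq_norm, quarterIntegral_eq p q x.2 hx1, Function.comp_apply, ← mul_sub,
    ← intervalIntegral.integral_mul_const, ← intervalIntegral.integral_sub
      (Continuous.intervalIntegrable (by fun_prop) _ _)
      (Continuous.intervalIntegrable (by fun_prop) _ _), norm_mul]
  simp only [← mul_sub]
  rw [show ‖(2 : ℂ)‖ = 2 by norm_num]
  gcongr

lemma continuous_phase_mul_integral (p q a b : ℝ) : Continuous fun t : ℝ =>
    exp (I * ((t : ℂ) ^ 3 + p * (t : ℂ) ^ 2 + q * t)) *
      ∫ η in a..b, exp (-(3 * I * t * (η : ℂ) ^ 2)) := by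
  refine Continuous.mul (by fun_prop) ?_
  exact intervalIntegral.continuous_parametric_intervalIntegral_of_continuous'
    (by unfold Function.uncurry; fun_prop) _ _

lemma integral_neg_zero_eq (t a : ℝ) : ∫ η in a..0, exp (-(3 * I * t * (η : ℂ) ^ 2)) =
    ∫ η in (0 : ℝ)..(-a), exp (-(3 * I * t * (η : ℂ) ^ 2)) := by
  have := intervalIntegral.integral_comp_neg (a := a) (b := 0)
    (fun η : ℝ => exp (-(3 * I * t * (η : ℂ) ^ 2)))
  simpa using this

/-- Under t ↦ -t the terms t³, qt and tη² change sign and pt² does not, so the phase becomes the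
negative of the one with -p. -/
lemma conj_quarterIntegral (p q α b : ℝ) :
    ∫ t in (-α)..0, exp (I * ((t : ℂ) ^ 3 + p * (t : ℂ) ^ 2 + q * t)) *
      (∫ η in (0 : ℝ)..b, exp (-(3 * I * t * (η : ℂ) ^ 2))) =
      (starRingEnd ℂ) (quarterIntegral (-p) q α b) := by
  rw [quarterIntegral, ← intervalIntegral.intervalIntegral_conj]
  have := intervalIntegral.integral_comp_neg (a := 0) (b := α) (fun t : ℝ =>
    exp (I * ((t : ℂ) ^ 3 + p * (t : ℂ) ^ 2 + q * t)) *
      (∫ η in (0 : ℝ)..b, exp (-(3 * I * t * (η : ℂ) ^ 2))))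
  rw [neg_zero] at this
  rw [← this]
  congr 1
  ext t
  rw [map_mul, ← exp_conj, ← intervalIntegral.intervalIntegral_conj]
  congr 1
  · congr 1
    simp only [map_mul, map_add, map_pow, conj_I, conj_ofReal]
    push_cast
    ring
  · congr 1
    ext η
    rw [← exp_conj]
    congr 1
    simp only [map_mul, map_neg, map_pow, conj_I, conj_ofReal, map_ofNat]
    push_cast
    ring

/-- The constant part of the phase after the shift `ξ = t - z/3`. -/
noncomputable def shiftPhase (x z : ℝ) : ℂ := exp (I * (x * z / 3 - 4 * z ^ 3 / 27))

/-- With t = ξ + z/3 one has -3ξη² - zη² = -3tη². The rectangle is cut at t = 0 and η = 0; evenness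
in η and conjugation for t < 0 bring all four pieces to `quarterIntegral`. -/
lemma fourierBox_umbilic (x z : ℝ) {a b : ℝ × ℝ} (h1 : a.1 ≤ b.1) (h2 : a.2 ≤ b.2) :
    fourierBox (umbilicInitial z) x 0 a b = 1 / (2 * (Real.pi : ℂ)) * (shiftPhase x z *
      (quarterIntegral (-2 * z) (z ^ 2 - x) (b.1 + z / 3) b.2 +
       quarterIntegral (-2 * z) (z ^ 2 - x) (b.1 + z / 3) (-a.2) +
       (starRingEnd ℂ) (quarterIntegral (2 * z) (z ^ 2 - x) (-(a.1 + z / 3)) b.2) +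
       (starRingEnd ℂ) (quarterIntegral (2 * z) (z ^ 2 - x) (-(a.1 + z / 3)) (-a.2)))) := by
  set E : ℝ → ℂ := fun t => exp (I * ((t : ℂ) ^ 3 + (-2 * z : ℝ) * (t : ℂ) ^ 2 + (z ^ 2 - x : ℝ) * t))
    with hE
  set f : ℝ → ℂ := fun t => E t * ∫ η in a.2..b.2, exp (-(3 * I * t * (η : ℂ) ^ 2)) with hf
  have hbox : ∫ p in Icc a b, exp (-I * ((x : ℂ) * (p.1 : ℂ) + ((0 : ℝ) : ℂ) * (p.2 : ℂ))) *
      umbilicInitial z p.1 p.2 = ∫ ξ in a.1..b.1, shiftPhase x z * f (ξ + z / 3) := by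
    rw [Icc_prod_eq, Measure.volume_eq_prod, setIntegral_prod,
      integral_Icc_eq_integral_Ioc, ← intervalIntegral.integral_of_le h1]
    · congr 1
      ext ξ
      rw [integral_Icc_eq_integral_Ioc, ← intervalIntegral.integral_of_le h2, hf, ← mul_assoc,
        ← intervalIntegral.integral_const_mul]
      congr 1
      ext η
      simp only [umbilicInitial, shiftPhase, hE]
      rw [← exp_add, ← exp_add, ← exp_add]
      congr 1
      push_cast
      ring
    · rw [← Icc_prod_eq]
      refine Continuous.integrableOn_Icc ?_
      unfold umbilicInitial
      fun_prop
  have hfc : Continuous f := continuous_phase_mul_integral _ _ _ _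
  have hsplit : ∀ u v : ℝ, ∫ t in u..v, f t =
      (∫ t in u..v, E t * ∫ η in (0 : ℝ)..b.2, exp (-(3 * I * t * (η : ℂ) ^ 2))) +
      ∫ t in u..v, E t * ∫ η in (0 : ℝ)..(-a.2), exp (-(3 * I * t * (η : ℂ) ^ 2)) := by
    intro u v
    rw [← intervalIntegral.integral_add
      ((continuous_phase_mul_integral _ _ _ _).intervalIntegrable _ _)
      ((continuous_phase_mul_integral _ _ _ _).intervalIntegrable _ _)]
    congr 1
    ext t
    rw [← mul_add, ← integral_neg_zero_eq, add_comm (∫ η in (0 : ℝ)..b.2, _),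
      intervalIntegral.integral_add_adjacent_intervals
        (Continuous.intervalIntegrable (by fun_prop) _ _)
        (Continuous.intervalIntegrable (by fun_prop) _ _)]
  have hneg : (2 * z : ℝ) = -(-2 * z) := by ring
  have hc : ∀ d : ℝ, (starRingEnd ℂ) (quarterIntegral (2 * z) (z ^ 2 - x) (-(a.1 + z / 3)) d) =
      ∫ t in (a.1 + z / 3)..0, E t * ∫ η in (0 : ℝ)..d, exp (-(3 * I * t * (η : ℂ) ^ 2)) := by
    intro d
    rw [hneg, ← conj_quarterIntegral, neg_neg]
  rw [fourierBox, hbox, intervalIntegral.integral_const_mul,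
    intervalIntegral.integral_comp_add_right, hc, hc,
    ← intervalIntegral.integral_add_adjacent_intervals (b := 0) (hfc.intervalIntegrable _ _)
      (hfc.intervalIntegrable _ _), hsplit, hsplit]
  simp only [quarterIntegral]
  ring

/-- The value of `E(x, 0, z)` in terms of integrals along rays. -/
noncomputable def umbilicValue (x z : ℝ) : ℂ :=
  1 / (2 * (Real.pi : ℂ)) * (shiftPhase x z * (2 *
    (((Real.sqrt Real.pi / Real.sqrt 3 : ℝ) : ℂ) * sexticUnit⁻¹ * rayIntegral (-2 * z) (z ^ 2 - x) +
      (starRingEnd ℂ) (((Real.sqrt Real.pi / Real.sqrt 3 : ℝ) : ℂ) * sexticUnit⁻¹ *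
        rayIntegral (2 * z) (z ^ 2 - x)))))

lemma tendsto_fourierBox_umbilic (x z : ℝ) :
    Tendsto (fun r => fourierBox (umbilicInitial z) x 0 r.1 r.2) boxFilter
      (𝓝 (umbilicValue x z)) := by
  have hf : boxFilter =
      (((atBot : Filter ℝ) ×ˢ (atBot : Filter ℝ)) ×ˢ ((atTop : Filter ℝ) ×ˢ (atTop : Filter ℝ))) := by
    rw [boxFilter, ← prod_atBot_atBot_eq, ← prod_atTop_atTop_eq]
  rw [hf]
  set l := (((atBot : Filter ℝ) ×ˢ (atBot : Filter ℝ)) ×ˢ ((atTop : Filter ℝ) ×ˢ (atTop : Filter ℝ)))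
  have ta1 : Tendsto (fun r : (ℝ × ℝ) × (ℝ × ℝ) => r.1.1) l atBot := tendsto_fst.comp tendsto_fst
  have ta2 : Tendsto (fun r : (ℝ × ℝ) × (ℝ × ℝ) => r.1.2) l atBot := tendsto_snd.comp tendsto_fst
  have tb1 : Tendsto (fun r : (ℝ × ℝ) × (ℝ × ℝ) => r.2.1) l atTop := tendsto_fst.comp tendsto_snd
  have tb2 : Tendsto (fun r : (ℝ × ℝ) × (ℝ × ℝ) => r.2.2) l atTop := tendsto_snd.comp tendsto_snd
  have sb1 : Tendsto (fun r : (ℝ × ℝ) × (ℝ × ℝ) => r.2.1 + z / 3) l atTop :=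
    tendsto_atTop_add_const_right _ _ tb1
  have sa1 : Tendsto (fun r : (ℝ × ℝ) × (ℝ × ℝ) => -(r.1.1 + z / 3)) l atTop :=
    tendsto_neg_atBot_atTop.comp (tendsto_atBot_add_const_right _ _ ta1)
  have sa2 : Tendsto (fun r : (ℝ × ℝ) × (ℝ × ℝ) => -r.1.2) l atTop :=
    tendsto_neg_atBot_atTop.comp ta2
  have q1 := (tendsto_quarterIntegral (-2 * z) (z ^ 2 - x)).comp (sb1.prodMk tb2)
  have q2 := (tendsto_quarterIntegral (-2 * z) (z ^ 2 - x)).comp (sb1.prodMk sa2)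
  have q3 := (continuous_conj.tendsto _).comp
    ((tendsto_quarterIntegral (2 * z) (z ^ 2 - x)).comp (sa1.prodMk tb2))
  have q4 := (continuous_conj.tendsto _).comp
    ((tendsto_quarterIntegral (2 * z) (z ^ 2 - x)).comp (sa1.prodMk sa2))
  have := ((((q1.add q2).add q3).add q4).const_mul (shiftPhase x z)).const_mul
    (1 / (2 * (Real.pi : ℂ)))
  refine Tendsto.congr' ?_ (this.trans (le_of_eq ?_))
  swap
  · congr 1
    rw [umbilicValue]
    ring
  filter_upwards [ta1.eventually_le_atBot 0, ta2.eventually_le_atBot 0,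
    tb1.eventually_ge_atTop 0, tb2.eventually_ge_atTop 0] with r h1 h2 h3 h4
  rw [fourierBox_umbilic x z (h1.trans h3) (h2.trans h4)]
  rfl

lemma umbilicConverges (x z : ℝ) : UmbilicConverges x 0 z := ⟨_, tendsto_fourierBox_umbilic x z⟩

lemma ellipticUmbilic_eq (x z : ℝ) : ellipticUmbilic x 0 z = umbilicValue x z :=
  have : NeBot boxFilter := by unfold boxFilter; infer_instance
  (tendsto_fourierBox_umbilic x z).limUnder_eq

/-! ### Double power series of the ray integral. -/

lemma hasSum_pow_div_factorial (x : ℂ) : HasSum (fun n : ℕ => x ^ n / n.factorial) (exp x) := by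
  rw [exp_eq_exp_ℂ]
  exact NormedSpace.expSeries_div_hasSum_exp x

lemma Real.hasSum_pow_div_factorial (x : ℝ) :
    HasSum (fun n : ℕ => x ^ n / n.factorial) (Real.exp x) := by
  rw [Real.exp_eq_exp_ℝ]
  exact NormedSpace.expSeries_div_hasSum_exp x

lemma hasSum_double_exp (x y : ℂ) : HasSum (fun r : ℕ × ℕ =>
    x ^ r.1 / r.1.factorial * (y ^ r.2 / r.2.factorial)) (exp x * exp y) :=
  HasSum.mul (f := fun n : ℕ => x ^ n / n.factorial) (g := fun n : ℕ => y ^ n / n.factorial)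
    (hasSum_pow_div_factorial x) (hasSum_pow_div_factorial y)
    (summable_mul_of_summable_norm (f := fun n : ℕ => x ^ n / n.factorial)
      (g := fun n : ℕ => y ^ n / n.factorial) (hasSum_pow_div_factorial x).summable.norm
      (hasSum_pow_div_factorial y).summable.norm)

lemma Real.hasSum_double_exp {x y : ℝ} (hx : 0 ≤ x) (hy : 0 ≤ y) : HasSum (fun r : ℕ × ℕ =>
    x ^ r.1 / r.1.factorial * (y ^ r.2 / r.2.factorial)) (Real.exp x * Real.exp y) := by
  have hx' := Real.hasSum_pow_div_factorial x
  have hy' := Real.hasSum_pow_div_factorial y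
  have h := hx'.summable.mul_of_nonneg hy'.summable (fun _ => by positivity)
    (fun _ => by positivity)
  exact hx'.mul hy' h

/-- Summation by weight, the second index counting twice. -/
lemma HasSum.regroup {f : ℕ × ℕ → ℂ} {a : ℂ} (h : HasSum f a) :
    HasSum (fun k => ∑ n ∈ Finset.range (k / 2 + 1), f (k - 2 * n, n)) a := by
  refine (congrArg (fun g => HasSum g a) (funext fun k => ?_)).mp
    (h.tsum_fiberwise (fun r : ℕ × ℕ => r.1 + 2 * r.2))
  have e : (fun r : ℕ × ℕ => r.1 + 2 * r.2) ⁻¹' {k} =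
      ((Finset.range (k / 2 + 1)).image fun n => (k - 2 * n, n) : Finset (ℕ × ℕ)) := by
    ext ⟨m, n⟩
    simp only [mem_preimage, mem_singleton_iff, Finset.coe_image, Finset.coe_range, mem_image,
      mem_Iio, Prod.mk.injEq]
    constructor
    · rintro rfl
      exact ⟨n, by omega, by omega, rfl⟩
    · rintro ⟨l, h1, h2, rfl⟩
      omega
  rw [e, Finset.tsum_subtype', Finset.sum_image fun a _ b _ hab => (Prod.mk.inj hab).2]

lemma integral_pow_mul_exp_neg_sextic (N : ℕ) :
    ∫ s in Ioi (0 : ℝ), (s : ℂ) ^ (2 * N) * exp (-(s : ℂ) ^ 6) =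
      Gamma ((2 * N + 1) / 6) / 6 := by
  have h := _root_.integral_rpow_mul_exp_neg_rpow (p := 6) (q := (2 * N : ℕ)) (by norm_num)
    (by have : (0 : ℝ) ≤ (2 * N : ℕ) := Nat.cast_nonneg _
        linarith)
  have e : ∫ s in Ioi (0 : ℝ), (s : ℂ) ^ (2 * N) * exp (-(s : ℂ) ^ 6) =
      ((∫ s in Ioi (0 : ℝ), s ^ ((2 * N : ℕ) : ℝ) * Real.exp (-s ^ (6 : ℝ)) : ℝ) : ℂ) := by
    rw [← integral_complex_ofReal]
    congr 1
    ext s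
    rw [Real.rpow_natCast, show (6 : ℝ) = (6 : ℕ) by norm_num, Real.rpow_natCast]
    push_cast
    rfl
  rw [e, h]
  push_cast
  rw [← Complex.Gamma_ofReal]
  push_cast
  ring

/-- Termwise integration of the double exponential series. -/
lemma hasSum_rayIntegral (p q : ℝ) : HasSum (fun r : ℕ × ℕ =>
    (I * p * sexticUnit ^ 2) ^ r.1 / r.1.factorial * ((I * q * sexticUnit) ^ r.2 / r.2.factorial) *
      (Gamma ((2 * ((2 * r.1 + r.2 : ℕ) : ℂ) + 1) / 6) / 6)) (rayIntegral p q) := by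
  set P : ℂ := I * p * sexticUnit ^ 2 with hP
  set Q : ℂ := I * q * sexticUnit with hQ
  have h := hasSum_integral_of_dominated_convergence (μ := volume.restrict (Ioi (0 : ℝ)))
    (F := fun (r : ℕ × ℕ) (s : ℝ) => ((P * (s : ℂ) ^ 4) ^ r.1 / r.1.factorial *
      ((Q * (s : ℂ) ^ 2) ^ r.2 / r.2.factorial)) * exp (-(s : ℂ) ^ 6))
    (f := fun s : ℝ => exp (-(s : ℂ) ^ 6 + I * p * sexticUnit ^ 2 * (s : ℂ) ^ 4
      + I * q * sexticUnit * (s : ℂ) ^ 2))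
    (fun r s => ((|p| * s ^ 4) ^ r.1 / r.1.factorial *
      ((|q| * s ^ 2) ^ r.2 / r.2.factorial)) * Real.exp (-s ^ 6))
    (fun r => Continuous.aestronglyMeasurable (by fun_prop)) ?_ ?_ ?_ ?_
  · refine (congrArg (fun g => HasSum g _) (funext fun r => ?_)).mp h
    rw [← integral_pow_mul_exp_neg_sextic, ← integral_const_mul]
    congr 1
    ext s
    ring
  · refine fun r => ae_of_all _ fun s => le_of_eq ?_
    simp only [norm_mul, norm_div, norm_pow, hP, hQ, norm_I, norm_sexticUnit, norm_real, norm_exp,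
      Complex.norm_natCast, one_mul, one_pow, mul_one, Real.norm_eq_abs]
    rw [(show Even 4 by decide).pow_abs, (show Even 2 by decide).pow_abs, ← ofReal_pow,
      ← ofReal_neg, ofReal_re]
  · exact ae_of_all _ fun s => ((Real.hasSum_double_exp (by positivity)
      (by positivity)).mul_right _).summable
  · have e : ∀ s : ℝ, ∑' r : ℕ × ℕ, ((|p| * s ^ 4) ^ r.1 / r.1.factorial *
        ((|q| * s ^ 2) ^ r.2 / r.2.factorial)) * Real.exp (-s ^ 6) =
        Real.exp (-s ^ 6 + |p| * s ^ 4 + |q| * s ^ 2 + 0) := fun s => by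
      rw [((Real.hasSum_double_exp (by positivity) (by positivity)).mul_right _).tsum_eq,
        ← Real.exp_add, ← Real.exp_add]
      congr 1
      ring
    simp only [e]
    exact integrableOn_exp_neg_sextic _ _ _
  · refine ae_of_all _ fun s => ?_
    have := (hasSum_double_exp (P * (s : ℂ) ^ 4) (Q * (s : ℂ) ^ 2)).mul_right (exp (-(s : ℂ) ^ 6))
    rw [← exp_add, ← exp_add] at this
    have e : P * (s : ℂ) ^ 4 + Q * (s : ℂ) ^ 2 + -(s : ℂ) ^ 6 =
        -(s : ℂ) ^ 6 + P * (s : ℂ) ^ 4 + Q * (s : ℂ) ^ 2 := by ring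
    rwa [e] at this

/-! ### Expansion about the inflection point of the cubic phase. -/

/-- The moments `∫ (τs² + h)ⁿ exp(i(τs² + h)³) ds`, entire functions of `h`. -/
noncomputable def shiftedMoment (n : ℕ) (h : ℂ) : ℂ :=
  ∫ s in Ioi (0 : ℝ), (sexticUnit * (s : ℂ) ^ 2 + h) ^ n *
    exp (I * (sexticUnit * (s : ℂ) ^ 2 + h) ^ 3)

/-- A majorant for the integrand of `shiftedMoment n` on the disc of radius `R`. -/
noncomputable def momentBound (n : ℕ) (R s : ℝ) : ℝ :=
  (s ^ 2 + R) ^ n * Real.exp (-s ^ 6 + 3 * R * s ^ 4 + 3 * R ^ 2 * s ^ 2 + R ^ 3)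

/-- The leading part iτ³s⁶ of the exponent equals -s⁶; the remaining terms are estimated by their
moduli. -/
lemma norm_moment_le {n : ℕ} {h : ℂ} {R : ℝ} (hR : ‖h‖ ≤ R) (s : ℝ) :
    ‖(sexticUnit * (s : ℂ) ^ 2 + h) ^ n * exp (I * (sexticUnit * (s : ℂ) ^ 2 + h) ^ 3)‖ ≤
      momentBound n R s := by
  have hs : ‖sexticUnit * (s : ℂ) ^ 2‖ = s ^ 2 := by
    rw [norm_mul, norm_sexticUnit, one_mul, norm_pow, norm_real, Real.norm_eq_abs, sq_abs]
  have hR0 : 0 ≤ R := (norm_nonneg h).trans hR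
  rw [norm_mul, norm_pow, momentBound]
  refine mul_le_mul ?_ ?_ (norm_nonneg _) (by positivity)
  · have : ‖sexticUnit * (s : ℂ) ^ 2 + h‖ ≤ s ^ 2 + R :=
      (norm_add_le _ _).trans (by rw [hs]; linarith)
    gcongr
  · have e : I * (sexticUnit * (s : ℂ) ^ 2 + h) ^ 3 = ((-s ^ 6 : ℝ) : ℂ) +
        3 * I * (sexticUnit * (s : ℂ) ^ 2) ^ 2 * h + 3 * I * (sexticUnit * (s : ℂ) ^ 2) * h ^ 2 +
        I * h ^ 3 := by
      push_cast
      linear_combination I * (s : ℂ) ^ 6 * sexticUnit_pow_three + (s : ℂ) ^ 6 * I_sq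
    rw [norm_exp, Real.exp_le_exp, e]
    simp only [add_re, ofReal_re]
    have b1 : (3 * I * (sexticUnit * (s : ℂ) ^ 2) ^ 2 * h).re ≤ 3 * R * s ^ 4 := by
      refine (re_le_norm _).trans ?_
      rw [norm_mul, norm_mul, norm_pow, hs, norm_mul, norm_I, RCLike.norm_ofNat]
      calc 3 * 1 * (s ^ 2) ^ 2 * ‖h‖ ≤ 3 * 1 * (s ^ 2) ^ 2 * R := by gcongr
        _ = 3 * R * s ^ 4 := by ring
    have b2 : (3 * I * (sexticUnit * (s : ℂ) ^ 2) * h ^ 2).re ≤ 3 * R ^ 2 * s ^ 2 := by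
      refine (re_le_norm _).trans ?_
      rw [norm_mul, norm_mul, norm_pow, hs, norm_mul, norm_I, RCLike.norm_ofNat]
      calc 3 * 1 * s ^ 2 * ‖h‖ ^ 2 ≤ 3 * 1 * s ^ 2 * R ^ 2 := by gcongr
        _ = 3 * R ^ 2 * s ^ 2 := by ring
    have b3 : (I * h ^ 3).re ≤ R ^ 3 := by
      refine (re_le_norm _).trans ?_
      rw [norm_mul, norm_I, one_mul, norm_pow]
      gcongr
    linarith

lemma momentBound_nonneg (n : ℕ) {R : ℝ} (hR : 0 ≤ R) (s : ℝ) : 0 ≤ momentBound n R s := by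
  unfold momentBound
  positivity

@[fun_prop]
lemma continuous_momentBound (n : ℕ) (R : ℝ) : Continuous (momentBound n R) := by
  unfold momentBound
  fun_prop

lemma integrableOn_momentBound_exp (R q : ℝ) : IntegrableOn
    (fun s => Real.exp (q * (s ^ 2 + R)) *
      Real.exp (-s ^ 6 + 3 * R * s ^ 4 + 3 * R ^ 2 * s ^ 2 + R ^ 3)) (Ioi 0) := by
  refine (integrableOn_exp_neg_sextic (3 * R) (3 * R ^ 2 + q) (q * R + R ^ 3)).congr_fun
    (fun s _ => ?_) measurableSet_Ioi
  dsimp only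
  rw [← Real.exp_add]
  congr 1
  ring

lemma integrableOn_momentBound (n : ℕ) {R : ℝ} (hR : 0 ≤ R) :
    IntegrableOn (momentBound n R) (Ioi 0) := by
  refine ((integrableOn_momentBound_exp R 1).const_mul (n.factorial : ℝ)).mono'
    (Continuous.aestronglyMeasurable (by fun_prop)) (ae_of_all _ fun s => ?_)
  rw [Real.norm_of_nonneg (momentBound_nonneg n hR s), momentBound, ← mul_assoc, one_mul]
  have := Real.pow_div_factorial_le_exp (s ^ 2 + R) (by positivity) n
  rw [div_le_iff₀ (by positivity), mul_comm] at this
  gcongr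

lemma integrable_shiftedMoment (n : ℕ) (h : ℂ) : IntegrableOn (fun s : ℝ =>
    (sexticUnit * (s : ℂ) ^ 2 + h) ^ n * exp (I * (sexticUnit * (s : ℂ) ^ 2 + h) ^ 3)) (Ioi 0) :=
  (integrableOn_momentBound n (norm_nonneg h)).mono'
    (Continuous.aestronglyMeasurable (by fun_prop)) (ae_of_all _ fun s => norm_moment_le le_rfl s)

lemma norm_shiftedMoment_le (n : ℕ) {h : ℂ} {R : ℝ} (hR : ‖h‖ ≤ R) :
    ‖shiftedMoment n h‖ ≤ ∫ s in Ioi 0, momentBound n R s :=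
  norm_integral_le_of_norm_le (integrableOn_momentBound n ((norm_nonneg h).trans hR))
    (ae_of_all _ fun s => norm_moment_le hR s)

lemma hasDerivAt_shiftedMoment (n : ℕ) (h : ℂ) : HasDerivAt (shiftedMoment n)
    (n * shiftedMoment (n - 1) h + 3 * I * shiftedMoment (n + 2) h) h := by
  set R : ℝ := ‖h‖ + 1 with hR
  have hR0 : 0 ≤ R := by positivity
  have key := hasDerivAt_integral_of_dominated_loc_of_deriv_le (μ := volume.restrict (Ioi (0 : ℝ)))
    (F := fun (h : ℂ) (s : ℝ) => (sexticUnit * (s : ℂ) ^ 2 + h) ^ n *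
      exp (I * (sexticUnit * (s : ℂ) ^ 2 + h) ^ 3)) (x₀ := h) (s := Metric.ball h 1)
    (F' := fun (h : ℂ) (s : ℝ) => n * ((sexticUnit * (s : ℂ) ^ 2 + h) ^ (n - 1) *
      exp (I * (sexticUnit * (s : ℂ) ^ 2 + h) ^ 3)) + 3 * I * ((sexticUnit * (s : ℂ) ^ 2 + h) ^ (n + 2) *
      exp (I * (sexticUnit * (s : ℂ) ^ 2 + h) ^ 3)))
    (bound := fun s => n * momentBound (n - 1) R s + 3 * momentBound (n + 2) R s)
    (Metric.ball_mem_nhds h one_pos)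
    (Eventually.of_forall fun h => Continuous.aestronglyMeasurable (by fun_prop))
    (integrable_shiftedMoment n h) (Continuous.aestronglyMeasurable (by fun_prop)) ?_
    (((integrableOn_momentBound _ hR0).const_mul _).add
      ((integrableOn_momentBound _ hR0).const_mul _)) ?_
  · refine key.2.congr_deriv ?_
    rw [integral_add ((integrable_shiftedMoment _ h).const_mul _)
      ((integrable_shiftedMoment _ h).const_mul _), integral_const_mul, integral_const_mul]
    rfl
  · refine ae_of_all _ fun s y hy => ?_
    have hy' : ‖y‖ ≤ R := by
      have := norm_le_norm_add_norm_sub' y h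
      rw [mem_ball_iff_norm] at hy
      linarith
    refine (norm_add_le _ _).trans (add_le_add ?_ ?_)
    · rw [norm_mul, Complex.norm_natCast]
      gcongr
      exact norm_moment_le hy' s
    · rw [norm_mul, norm_mul, norm_I, RCLike.norm_ofNat, mul_one]
      gcongr
      exact norm_moment_le hy' s
  · refine ae_of_all _ fun s y _ => ?_
    have hd := (hasDerivAt_id y).const_add (sexticUnit * (s : ℂ) ^ 2)
    refine ((hd.fun_pow n).mul ((hd.fun_pow 3).const_mul I).cexp).congr_deriv ?_
    simp only [id]
    push_cast
    ring

lemma differentiable_shiftedMoment (n : ℕ) : Differentiable ℂ (shiftedMoment n) :=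
  fun h => (hasDerivAt_shiftedMoment n h).differentiableAt

lemma Gamma_odd_div_six_add_one (N : ℤ) : Gamma ((2 * ((N + 3 : ℤ) : ℂ) + 1) / 6) =
    (2 * N + 1) / 6 * Gamma ((2 * N + 1) / 6) := by
  rw [← Gamma_add_one]
  · congr 1
    push_cast
    ring
  · intro h
    have h2 : ((2 * N + 1 : ℤ) : ℂ) = 0 := by
      push_cast
      linear_combination 6 * h
    have := Int.cast_eq_zero.1 h2
    omega

/-- Induction through M_n' = n M_{n-1} + 3i M_{n+2}. With N = n - j - 1 the two terms involve Γ at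
(2N+1)/6 and at that point plus 1, and 3iτ³ = -3. Their sum has the factor n - (2N+1)/2 = j + 1/2,
whence the Pochhammer symbol of 1/2. -/
lemma iteratedDeriv_shiftedMoment (j : ℕ) : ∀ n : ℕ, iteratedDeriv j (shiftedMoment n) 0 =
    (ascPochhammer ℂ j).eval (1 / 2) * sexticUnit ^ ((n : ℤ) - j) *
      (Gamma ((2 * (((n : ℤ) - j : ℤ) : ℂ) + 1) / 6) / 6) := by
  induction j with
  | zero =>
    intro n
    have h := integral_pow_mul_exp_neg_sextic n
    simp only [iteratedDeriv_zero, ascPochhammer_zero, Polynomial.eval_one, one_mul,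
      Nat.cast_zero, sub_zero, zpow_natCast, Int.cast_natCast]
    rw [← h, shiftedMoment, ← integral_const_mul]
    congr 1
    ext s
    rw [add_zero, mul_pow, ← pow_mul, mul_assoc]
    congr 3
    linear_combination I * (s : ℂ) ^ 6 * sexticUnit_pow_three + (s : ℂ) ^ 6 * I_sq
  | succ j ih =>
    intro n
    have hd : deriv (shiftedMoment n) =
        fun h => n * shiftedMoment (n - 1) h + 3 * I * shiftedMoment (n + 2) h :=
      funext fun h => (hasDerivAt_shiftedMoment n h).deriv
    have hc : ∀ m, ContDiffAt ℂ j (shiftedMoment m) 0 := fun m =>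
      (differentiable_shiftedMoment m).contDiff.contDiffAt
    rw [iteratedDeriv_succ', hd, iteratedDeriv_fun_add (contDiffAt_const.mul (hc _))
      (contDiffAt_const.mul (hc _)), iteratedDeriv_const_mul_field, iteratedDeriv_const_mul_field,
      ih (n + 2)]
    have h1 : (n : ℂ) * iteratedDeriv j (shiftedMoment (n - 1)) 0 =
        n * ((ascPochhammer ℂ j).eval (1 / 2) * sexticUnit ^ ((n : ℤ) - (j + 1 : ℕ)) *
      (Gamma ((2 * (((n : ℤ) - (j + 1 : ℕ) : ℤ) : ℂ) + 1) / 6) / 6)) := by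
      -- For n = 0 the truncated index n - 1 does not matter, since the factor n vanishes on both
      -- sides.
      rcases n with _ | n
      · simp
      · rw [ih, show n + 1 - 1 = n from rfl, show ((n + 1 : ℕ) : ℤ) - (j + 1 : ℕ) = n - j by
          push_cast; ring]
    have e3 : (((n + 2 : ℕ) : ℤ) - j) = ((n : ℤ) - (j + 1 : ℕ)) + 3 := by push_cast; ring
    have hz : sexticUnit ^ (((n : ℤ) - (j + 1 : ℕ)) + 3) =
        sexticUnit ^ ((n : ℤ) - (j + 1 : ℕ)) * I := by
      rw [zpow_add₀ sexticUnit_ne_zero, ← sexticUnit_pow_three]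
      norm_cast
    rw [h1, e3, Gamma_odd_div_six_add_one, hz, ascPochhammer_succ_eval]
    push_cast
    linear_combination (ascPochhammer ℂ j).eval (1 / 2 : ℂ) * sexticUnit ^ ((n : ℤ) - (j + 1)) *
      (2 * (n - (j + 1 : ℂ)) + 1) / 2 * (Gamma ((2 * (n - (j + 1 : ℂ)) + 1) / 6) / 6) * I_sq

lemma hasSum_momentBound (q R s : ℝ) :
    HasSum (fun n : ℕ => |q| ^ n / n.factorial * momentBound n R s)
      (Real.exp (|q| * (s ^ 2 + R)) *
        Real.exp (-s ^ 6 + 3 * R * s ^ 4 + 3 * R ^ 2 * s ^ 2 + R ^ 3)) := by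
  refine (congrArg (fun g => HasSum g _) (funext fun n => ?_)).mp
    ((Real.hasSum_pow_div_factorial (|q| * (s ^ 2 + R))).mul_right _)
  rw [momentBound, mul_pow]
  ring

/-- Summing under the integral turns the powers of s² + R into an exponential, still integrable
against exp(-s⁶ + ⋯). -/
lemma summable_momentBound {R : ℝ} (hR : 0 ≤ R) (q : ℝ) : Summable fun n : ℕ =>
    |q| ^ n / n.factorial * ∫ s in Ioi 0, momentBound n R s := by
  have hs := hasSum_momentBound q R
  have h := hasSum_integral_of_dominated_convergence (μ := volume.restrict (Ioi (0 : ℝ)))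
    (F := fun (n : ℕ) (s : ℝ) => |q| ^ n / n.factorial * momentBound n R s)
    (fun n s => |q| ^ n / n.factorial * momentBound n R s)
    (fun n => Continuous.aestronglyMeasurable (by fun_prop))
    (fun n => ae_of_all _ fun s => (Real.norm_of_nonneg
      (mul_nonneg (by positivity) (momentBound_nonneg n hR s))).le)
    (ae_of_all _ fun s => (hs s).summable)
    (by simp only [(hs _).tsum_eq]; exact integrableOn_momentBound_exp _ _)
    (ae_of_all _ hs)
  simpa only [integral_const_mul] using h.summable

/-- Completion of the cube in w = τs², for which iw³ = -s⁶. -/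
lemma rayIntegral_eq_shifted (p q : ℝ) :
    exp (I * ((p / 3 : ℂ) ^ 3 + (q - p ^ 2 / 3) * (p / 3))) * rayIntegral p q =
      ∫ s in Ioi (0 : ℝ), exp (I * (q - p ^ 2 / 3) * (sexticUnit * (s : ℂ) ^ 2 + p / 3)) *
        exp (I * (sexticUnit * (s : ℂ) ^ 2 + p / 3) ^ 3) := by
  rw [rayIntegral, ← integral_const_mul]
  congr 1
  ext s
  rw [← exp_add, ← exp_add]
  congr 1
  linear_combination -(I * (s : ℂ) ^ 6 * sexticUnit_pow_three) - (s : ℂ) ^ 6 * I_sq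

lemma hasSum_shiftedMoment (p q : ℝ) : HasSum (fun n : ℕ =>
    (I * (q - p ^ 2 / 3)) ^ n / n.factorial * shiftedMoment n (p / 3))
    (exp (I * ((p / 3 : ℂ) ^ 3 + (q - p ^ 2 / 3) * (p / 3))) * rayIntegral p q) := by
  set r : ℝ := q - p ^ 2 / 3 with hr
  have hrc : (q - p ^ 2 / 3 : ℂ) = (r : ℂ) := by rw [hr]; push_cast; ring
  have hR : ‖(p / 3 : ℂ)‖ ≤ |p| / 3 := by
    rw [norm_div, norm_real, RCLike.norm_ofNat, Real.norm_eq_abs]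
  have hR0 : 0 ≤ |p| / 3 := by positivity
  have hs : ∀ s : ℝ, HasSum (fun n : ℕ => |r| ^ n / n.factorial * momentBound n (|p| / 3) s)
      (Real.exp (|r| * (s ^ 2 + |p| / 3)) * Real.exp (-s ^ 6 + 3 * (|p| / 3) * s ^ 4 +
        3 * (|p| / 3) ^ 2 * s ^ 2 + (|p| / 3) ^ 3)) := hasSum_momentBound _ _
  rw [rayIntegral_eq_shifted, hrc]
  have h := hasSum_integral_of_dominated_convergence (μ := volume.restrict (Ioi (0 : ℝ)))
    (F := fun (n : ℕ) (s : ℝ) => (I * r) ^ n / n.factorial *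
      ((sexticUnit * (s : ℂ) ^ 2 + p / 3) ^ n * exp (I * (sexticUnit * (s : ℂ) ^ 2 + p / 3) ^ 3)))
    (f := fun s : ℝ => exp (I * r * (sexticUnit * (s : ℂ) ^ 2 + p / 3)) *
        exp (I * (sexticUnit * (s : ℂ) ^ 2 + p / 3) ^ 3))
    (fun n s => |r| ^ n / n.factorial * momentBound n (|p| / 3) s)
    (fun n => Continuous.aestronglyMeasurable (by fun_prop))
    (fun n => ae_of_all _ fun s => ?_)
    (ae_of_all _ fun s => (hs s).summable)
    (by simp only [(hs _).tsum_eq]; exact integrableOn_momentBound_exp _ _)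
    (ae_of_all _ fun s => ?_)
  · simpa only [integral_const_mul, shiftedMoment] using h
  · rw [norm_mul]
    refine mul_le_mul (le_of_eq ?_) (norm_moment_le hR s) (norm_nonneg _) (by positivity)
    rw [norm_div, norm_pow, norm_mul, norm_I, one_mul, norm_real, Complex.norm_natCast,
      Real.norm_eq_abs]
  · refine (congrArg (fun g => HasSum g _) (funext fun n => ?_)).mp
      ((hasSum_pow_div_factorial (I * r * (sexticUnit * (s : ℂ) ^ 2 + p / 3))).mul_right
        (exp (I * (sexticUnit * (s : ℂ) ^ 2 + p / 3) ^ 3)))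
    rw [mul_pow]
    ring

lemma hasSum_taylor_shiftedMoment (n : ℕ) (h : ℂ) : HasSum (fun j : ℕ =>
    h ^ j / j.factorial * iteratedDeriv j (shiftedMoment n) 0) (shiftedMoment n h) := by
  refine (congrArg (fun g => HasSum g _) (funext fun j => ?_)).mp
    (hasSum_taylorSeries_of_entire (differentiable_shiftedMoment n) 0 h)
  rw [sub_zero, smul_eq_mul, smul_eq_mul]
  ring

lemma norm_iteratedDeriv_shiftedMoment_le (n j : ℕ) {R : ℝ} (hR : 0 < R) :
    ‖iteratedDeriv j (shiftedMoment n) 0‖ ≤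
      j.factorial * (∫ s in Ioi 0, momentBound n R s) / R ^ j :=
  norm_iteratedDeriv_le_of_forall_mem_sphere_norm_le j hR
    (differentiable_shiftedMoment n).diffContOnCl
    (fun y hy => norm_shiftedMoment_le n (by simpa using (mem_sphere_zero_iff_norm.1 hy).le))

/-- Cauchy's estimate on a circle of radius R > 2‖h‖ gives a geometric factor 2⁻ʲ. As R does not
depend on n, the other factor is the series of `summable_momentBound`. -/
lemma summable_double_moment (h : ℂ) (r : ℝ) : Summable fun x : ℕ × ℕ =>
    h ^ x.1 / x.1.factorial * ((I * r) ^ x.2 / x.2.factorial) *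
      iteratedDeriv x.1 (shiftedMoment x.2) 0 := by
  set R : ℝ := 2 * ‖h‖ + 1 with hR
  have hR0 : 0 < R := by positivity
  have hb := summable_geometric_two.mul_of_nonneg (summable_momentBound hR0.le r)
    (fun _ => by positivity)
    (fun n => mul_nonneg (by positivity) (integral_nonneg (momentBound_nonneg n hR0.le)))
  refine Summable.of_norm_bounded hb fun x => ?_
  have hI : 0 ≤ ∫ s in Ioi 0, momentBound x.2 R s := integral_nonneg (momentBound_nonneg x.2 hR0.le)
  have hratio : ‖h‖ / R ≤ 1 / 2 := by
    rw [div_le_iff₀ hR0]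
    linarith
  rw [norm_mul, norm_mul, norm_div, norm_div, norm_pow, norm_pow, norm_mul, norm_I, one_mul,
    norm_real, Complex.norm_natCast, Complex.norm_natCast, Real.norm_eq_abs]
  calc ‖h‖ ^ x.1 / x.1.factorial * (|r| ^ x.2 / x.2.factorial) *
        ‖iteratedDeriv x.1 (shiftedMoment x.2) 0‖
      ≤ ‖h‖ ^ x.1 / x.1.factorial * (|r| ^ x.2 / x.2.factorial) *
        (x.1.factorial * (∫ s in Ioi 0, momentBound x.2 R s) / R ^ x.1) := by
        gcongr
        exact norm_iteratedDeriv_shiftedMoment_le _ _ hR0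
    _ = (‖h‖ / R) ^ x.1 * (|r| ^ x.2 / x.2.factorial * ∫ s in Ioi 0, momentBound x.2 R s) := by
        have : (x.1.factorial : ℝ) ≠ 0 := by positivity
        rw [div_pow]
        field_simp
    _ ≤ (1 / 2) ^ x.1 * (|r| ^ x.2 / x.2.factorial * ∫ s in Ioi 0, momentBound x.2 R s) := by
        gcongr

/-- Expansion of the ray integral about the inflection point of the cubic phase. -/
lemma hasSum_rayIntegral_shifted (p q : ℝ) : HasSum (fun x : ℕ × ℕ =>
    (p / 3 : ℂ) ^ x.1 / x.1.factorial * ((I * (q - p ^ 2 / 3)) ^ x.2 / x.2.factorial) *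
      ((ascPochhammer ℂ x.1).eval (1 / 2) * sexticUnit ^ ((x.2 : ℤ) - x.1) *
        (Gamma ((2 * (((x.2 : ℤ) - x.1 : ℤ) : ℂ) + 1) / 6) / 6)))
    (exp (I * ((p / 3 : ℂ) ^ 3 + (q - p ^ 2 / 3) * (p / 3))) * rayIntegral p q) := by
  have hs := summable_double_moment (p / 3) (q - p ^ 2 / 3)
  push_cast at hs
  have h1 := (Equiv.prodComm ℕ ℕ).hasSum_iff.2 hs.hasSum
  have h2 := h1.prod_fiberwise (g := fun n : ℕ =>
    (I * (q - p ^ 2 / 3)) ^ n / n.factorial * shiftedMoment n (p / 3)) fun n => by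
      refine (congrArg (fun g => HasSum g _) (funext fun j => ?_)).mp
        ((hasSum_taylor_shiftedMoment n (p / 3)).mul_left
          ((I * (q - p ^ 2 / 3)) ^ n / n.factorial))
      simp only [Function.comp_apply, Equiv.prodComm_apply, Prod.swap_prod_mk]
      ring
  have h3 := hs.hasSum
  -- Summing over j first identifies the value of the absolutely convergent double series.
  rw [h2.unique (hasSum_shiftedMoment p q)] at h3
  simpa only [iteratedDeriv_shiftedMoment] using h3

/-! ### Pochhammer symbols and the reflection formula. -/

lemma ascPochhammer_succ_eval_left (n : ℕ) (x : ℂ) :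
    (ascPochhammer ℂ (n + 1)).eval x = x * (ascPochhammer ℂ n).eval (x + 1) := by
  simp [ascPochhammer_succ_left]

/-- The duplication formula for Pochhammer symbols. -/
lemma ascPochhammer_two_mul (n : ℕ) (x : ℂ) : (ascPochhammer ℂ (2 * n)).eval (2 * x) =
    4 ^ n * ((ascPochhammer ℂ n).eval x * (ascPochhammer ℂ n).eval (x + 1 / 2)) := by
  induction n with
  | zero => simp
  | succ n ih =>
    rw [show 2 * (n + 1) = 2 * n + 1 + 1 by ring, ascPochhammer_succ_eval, ascPochhammer_succ_eval,
      ih, ascPochhammer_succ_eval, ascPochhammer_succ_eval]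
    push_cast
    ring

lemma ascPochhammer_eval_neg_nat {N k : ℕ} (h : N ≤ k) :
    (ascPochhammer ℂ N).eval (-(k : ℂ)) * (k - N).factorial = (-1) ^ N * k.factorial := by
  induction N with
  | zero => simp
  | succ N ih =>
    have h1 := ih (by omega)
    rw [show k - N = (k - (N + 1)) + 1 by omega, Nat.factorial_succ] at h1
    have h2 : ((k - (N + 1) : ℕ) : ℂ) = k - (N + 1) := by
      rw [Nat.cast_sub h]
      push_cast
      ring
    push_cast [h2] at h1
    rw [ascPochhammer_succ_eval, pow_succ]
    linear_combination -h1

/-- The numerator of both terminating series. -/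
lemma ascPochhammer_half_neg {n k : ℕ} (h : 2 * n ≤ k) :
    (ascPochhammer ℂ n).eval (-(k : ℂ) / 2) * (ascPochhammer ℂ n).eval ((1 - (k : ℂ)) / 2) =
      k.factorial / (4 ^ n * (k - 2 * n).factorial) := by
  have h1 := ascPochhammer_two_mul n (-(k : ℂ) / 2)
  rw [show 2 * (-(k : ℂ) / 2) = -k by ring,
    show -(k : ℂ) / 2 + 1 / 2 = (1 - (k : ℂ)) / 2 by ring] at h1
  have h2 := ascPochhammer_eval_neg_nat h
  rw [h1, pow_mul, neg_one_sq, one_pow, one_mul] at h2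
  have h3 : (((k - 2 * n).factorial : ℕ) : ℂ) ≠ 0 := by exact_mod_cast Nat.factorial_ne_zero _
  rw [eq_div_iff (mul_ne_zero (pow_ne_zero _ (by norm_num)) h3)]
  linear_combination h2

lemma ascPochhammer_half_neg_eq_zero {n k : ℕ} (h : k < 2 * n) :
    (ascPochhammer ℂ n).eval (-(k : ℂ) / 2) * (ascPochhammer ℂ n).eval ((1 - (k : ℂ)) / 2) = 0 := by
  have h1 := ascPochhammer_two_mul n (-(k : ℂ) / 2)
  rw [show 2 * (-(k : ℂ) / 2) = -k by ring, ascPochhammer_eval_neg_coe_nat_of_lt h,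
    show -(k : ℂ) / 2 + 1 / 2 = (1 - (k : ℂ)) / 2 by ring] at h1
  simpa using h1.symm

/-- The last N factors are reversed and their signs changed. Followed by duplication with N = 2n,
this produces the lower parameters of the ₃F₂. -/
lemma ascPochhammer_one_half_add (j N : ℕ) : (ascPochhammer ℂ (j + N)).eval (1 / 2) =
    (-1) ^ N * ((ascPochhammer ℂ j).eval (1 / 2) *
      (ascPochhammer ℂ N).eval (1 / 2 - ((j + N : ℕ) : ℂ))) := by
  induction N with
  | zero => simp
  | succ N ih =>
    rw [← add_assoc, ascPochhammer_succ_eval, ih, ascPochhammer_succ_eval_left]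
    push_cast
    rw [show (1 / 2 - ((j : ℂ) + N + 1) + 1) = 1 / 2 - (j + N) by ring]
    ring

/-- An odd integer over an even one is never an integer. This keeps the Gamma arguments away from
poles and the Pochhammer denominators away from zero. -/
lemma ne_neg_nat_of_odd_div {d N : ℤ} {x : ℂ} (hd : Even d) (hN : Odd N) (hx : d * x = N) (k : ℕ) :
    x ≠ -(k : ℂ) := by
  rintro rfl
  have h : ((d * -(k : ℤ) : ℤ) : ℂ) = (N : ℤ) := by
    push_cast
    exact hx
  have h2 : d * -(k : ℤ) = N := by exact_mod_cast h
  rw [← h2] at hN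
  exact (Int.not_even_iff_odd.2 hN) (hd.mul_right _)

lemma ascPochhammer_ne_zero_of_ne_neg {x : ℂ} (hx : ∀ k : ℕ, x ≠ -(k : ℂ)) (n : ℕ) :
    (ascPochhammer ℂ n).eval x ≠ 0 := by
  rw [Ne, ascPochhammer_eval_eq_zero_iff]
  rintro ⟨k, -, hk⟩
  exact hx k (by rw [hk, neg_neg])

lemma Gamma_add_nat {x : ℂ} (hx : ∀ k : ℕ, x ≠ -(k : ℂ)) (n : ℕ) :
    Gamma (x + n) = Gamma x * (ascPochhammer ℂ n).eval x := by
  rw [← Gamma_add_nat_div_Gamma_eq x hx, mul_div_cancel₀ _ (Gamma_ne_zero hx)]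

lemma Gamma_eq_pi_div {x : ℂ} (hx : ∀ k : ℕ, x ≠ -(k : ℂ)) (hx' : ∀ k : ℕ, 1 - x ≠ -(k : ℂ)) :
    sin (Real.pi * x) ≠ 0 ∧ Gamma x = Real.pi / (sin (Real.pi * x) * Gamma (1 - x)) := by
  have h := Gamma_mul_Gamma_one_sub x
  have h1 := Gamma_ne_zero hx
  have h2 := Gamma_ne_zero hx'
  have hs : sin (Real.pi * x) ≠ 0 := by
    intro hs
    -- Since division by zero gives 0, a vanishing sine would make the product of two nonzero Gamma
    -- values zero.
    rw [hs, div_zero] at h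
    exact mul_ne_zero h1 h2 h
  refine ⟨hs, ?_⟩
  rw [eq_div_iff (mul_ne_zero hs h2)]
  rw [eq_div_iff hs] at h
  linear_combination h

/-! ### Trigonometric identities in powers of exp(πi/6). -/

lemma sexticUnit_zpow (N : ℤ) : sexticUnit ^ N = exp (N * (Real.pi / 6) * I) := by
  rw [sexticUnit, ← exp_int_mul]
  congr 1
  push_cast
  ring

lemma sexticUnit_zpow_six (k : ℤ) : sexticUnit ^ (6 * k) = (-1) ^ k := by
  rw [zpow_mul]
  congr 1
  rw [show (6 : ℤ) = ((3 * 2 : ℕ) : ℤ) by norm_num, zpow_natCast, pow_mul, sexticUnit_pow_three, I_sq]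

lemma sin_pi_mul_div_six (N : ℤ) : sin (Real.pi * (N / 6)) =
    (sexticUnit ^ (-N) - sexticUnit ^ N) * I / 2 := by
  rw [sexticUnit_zpow, sexticUnit_zpow, Complex.sin]
  congr 3
  · congr 2
    push_cast
    ring
  · congr 1
    ring

lemma omegaRoot_im (k : ℕ) : ((omegaRoot ^ (k + 1)).im : ℂ) =
    sin (Real.pi * (((4 * (k + 1) : ℤ) : ℂ) / 6)) := by
  have h : omegaRoot ^ (k + 1) = exp ((Real.pi * (4 * (k + 1) / 6) : ℝ) * I) := by
    rw [omegaRoot, ← Complex.exp_nat_mul]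
    congr 1
    push_cast
    ring
  rw [h, exp_ofReal_mul_I_im]
  push_cast
  ring_nf

lemma neg_one_zpow_mul_unit (k : ℤ) (N : ℤ) :
    (-1 : ℂ) ^ k * sexticUnit ^ N = sexticUnit ^ (N + 6 * k) := by
  rw [zpow_add₀ sexticUnit_ne_zero, sexticUnit_zpow_six, mul_comm]

lemma sexticUnit_zpow_add_six_mul (N k : ℤ) :
    sexticUnit ^ (N + 6 * k) = (-1) ^ k * sexticUnit ^ N := (neg_one_zpow_mul_unit k N).symm

lemma sexticUnit_zpow_three : sexticUnit ^ (3 : ℤ) = I := by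
  rw [← sexticUnit_pow_three]
  norm_cast

lemma sexticUnit_zpow_neg_three : sexticUnit ^ (-3 : ℤ) = -I := by
  rw [zpow_neg, sexticUnit_zpow_three, inv_I]

lemma neg_one_zpow_neg (k : ℤ) : (-1 : ℂ) ^ (-k) = (-1) ^ k := by
  rw [zpow_neg, ← inv_zpow]
  norm_num

/-- Product-to-sum: of the four products of powers of τ two are τ³ and τ⁻³, that is ±i, and cancel;
the other two reduce by τ⁶ = -1 to the left side. The sine is the one that the reflection formula
produces in `right_Gamma`. -/
lemma unit_identity_right (k : ℕ) :
    (-1) ^ k * (sexticUnit ^ (2 * k - 1 : ℤ) + sexticUnit ^ (-(2 * k - 1) : ℤ)) =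
      4 * ((omegaRoot ^ (k + 1)).im : ℂ) * sin (Real.pi * (((4 * k + 1 : ℤ) : ℂ) / 6)) := by
  rw [omegaRoot_im, sin_pi_mul_div_six, sin_pi_mul_div_six]
  have e : 4 * ((sexticUnit ^ (-(4 * (k + 1)) : ℤ) - sexticUnit ^ (4 * (k + 1) : ℤ)) * I / 2) *
      ((sexticUnit ^ (-(4 * k + 1) : ℤ) - sexticUnit ^ (4 * k + 1 : ℤ)) * I / 2) =
      I ^ 2 * (sexticUnit ^ (-(4 * (k + 1)) : ℤ) * sexticUnit ^ (-(4 * k + 1) : ℤ)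
        - sexticUnit ^ (-(4 * (k + 1)) : ℤ) * sexticUnit ^ (4 * k + 1 : ℤ)
        - sexticUnit ^ (4 * (k + 1) : ℤ) * sexticUnit ^ (-(4 * k + 1) : ℤ)
        + sexticUnit ^ (4 * (k + 1) : ℤ) * sexticUnit ^ (4 * k + 1 : ℤ)) := by ring
  rw [e, I_sq]
  simp only [← zpow_add₀ sexticUnit_ne_zero]
  rw [show (-(4 * (k + 1)) + -(4 * k + 1) : ℤ) = -(2 * k - 1) + 6 * (-(k + 1)) by ring,
    show (-(4 * (k + 1)) + (4 * k + 1) : ℤ) = -3 by ring,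
    show (4 * (k + 1) + -(4 * k + 1) : ℤ) = 3 by ring,
    show (4 * (k + 1) + (4 * k + 1) : ℤ) = (2 * k - 1) + 6 * (k + 1) by ring,
    sexticUnit_zpow_add_six_mul, sexticUnit_zpow_add_six_mul, neg_one_zpow_neg,
    sexticUnit_zpow_three, sexticUnit_zpow_neg_three, zpow_add_one₀ (by norm_num : (-1 : ℂ) ≠ 0), zpow_natCast]
  ring

/-- The same product-to-sum argument; the cross terms are now (-1)ᵏ(±i) and cancel again. -/
lemma unit_identity_left (k : ℕ) :
    (-1) ^ k * (sexticUnit ^ (4 * k + 1 : ℤ) + sexticUnit ^ (-(4 * k + 1) : ℤ)) =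
      4 * ((omegaRoot ^ (k + 1)).im : ℂ) * sin (Real.pi * (((1 - 2 * k : ℤ) : ℂ) / 6)) := by
  rw [omegaRoot_im, sin_pi_mul_div_six, sin_pi_mul_div_six]
  have e : 4 * ((sexticUnit ^ (-(4 * (k + 1)) : ℤ) - sexticUnit ^ (4 * (k + 1) : ℤ)) * I / 2) *
      ((sexticUnit ^ (-(1 - 2 * k) : ℤ) - sexticUnit ^ (1 - 2 * k : ℤ)) * I / 2) =
      I ^ 2 * (sexticUnit ^ (-(4 * (k + 1)) : ℤ) * sexticUnit ^ (-(1 - 2 * k) : ℤ)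
        - sexticUnit ^ (-(4 * (k + 1)) : ℤ) * sexticUnit ^ (1 - 2 * k : ℤ)
        - sexticUnit ^ (4 * (k + 1) : ℤ) * sexticUnit ^ (-(1 - 2 * k) : ℤ)
        + sexticUnit ^ (4 * (k + 1) : ℤ) * sexticUnit ^ (1 - 2 * k : ℤ)) := by ring
  rw [e, I_sq]
  simp only [← zpow_add₀ sexticUnit_ne_zero]
  rw [show (-(4 * (k + 1)) + -(1 - 2 * k) : ℤ) = (4 * k + 1) + 6 * (-(k + 1)) by ring,
    show (-(4 * (k + 1)) + (1 - 2 * k) : ℤ) = -3 + 6 * (-k) by ring,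
    show (4 * (k + 1) + -(1 - 2 * k) : ℤ) = 3 + 6 * k by ring,
    show (4 * (k + 1) + (1 - 2 * k) : ℤ) = -(4 * k + 1) + 6 * (k + 1) by ring,
    sexticUnit_zpow_add_six_mul, sexticUnit_zpow_add_six_mul, sexticUnit_zpow_add_six_mul,
    sexticUnit_zpow_add_six_mul, neg_one_zpow_neg, neg_one_zpow_neg,
    sexticUnit_zpow_three, sexticUnit_zpow_neg_three, zpow_add_one₀ (by norm_num : (-1 : ℂ) ≠ 0), zpow_natCast]
  ring

lemma conj_sexticUnit : (starRingEnd ℂ) sexticUnit = sexticUnit⁻¹ := by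
  rw [sexticUnit, ← exp_conj, ← exp_neg]
  simp [conj_ofReal, map_ofNat (starRingEnd ℂ)]

/-! ### Matching the coefficients of the two series. -/

/-- The coefficient `√π/√3`. -/
noncomputable def rootRatio : ℝ := Real.sqrt Real.pi / Real.sqrt 3

/-- By duplication (-k/2)_n ((1-k)/2)_n is (-k)_{2n}/4ⁿ, which vanishes for 2n > k. -/
lemma rightTerm_eq_sum (c z : ℝ) (k : ℕ) : rightTerm c z k =
    ∑ n ∈ Finset.range (k / 2 + 1), ((omegaRoot ^ (k + 1)).im : ℂ) * (2 * I * (z : ℂ)) ^ k /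
      (Gamma ((5 - 4 * (k : ℂ)) / 6) * (k.factorial : ℂ)) *
      ((n.factorial : ℂ)⁻¹ * (ascPochhammer ℂ n).eval (-(k : ℂ) / 2) *
        (ascPochhammer ℂ n).eval ((1 - (k : ℂ)) / 2) *
        ((ascPochhammer ℂ n).eval ((5 - 4 * (k : ℂ)) / 6))⁻¹ * (1 - (c : ℂ)) ^ n) := by
  rw [rightTerm, ordinaryHypergeometric_eq_tsum, ← Finset.mul_sum]
  congr 1
  refine tsum_eq_sum fun n hn => ?_
  have hk : k < 2 * n := by
    rw [Finset.mem_range] at hn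
    omega
  have h := ascPochhammer_half_neg_eq_zero hk
  rw [smul_eq_mul, mul_assoc ((n.factorial : ℂ)⁻¹), h]
  simp

lemma leftTerm_eq_sum (c z : ℝ) (k : ℕ) : leftTerm c z k =
    ∑ n ∈ Finset.range (k / 2 + 1), ((omegaRoot ^ (k + 1)).im : ℂ) *
      ((ascPochhammer ℂ k).eval (1 / 2) * (2 / 3 * I * (z : ℂ)) ^ k) /
      (Gamma ((5 + 2 * (k : ℂ)) / 6) * (k.factorial : ℂ)) *
      ((ascPochhammer ℂ n).eval (-(k : ℂ) / 2) * ((ascPochhammer ℂ n).eval ((1 - (k : ℂ)) / 2) *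
        (ascPochhammer ℂ n).eval ((1 - 2 * (k : ℂ)) / 6)) /
        ((ascPochhammer ℂ n).eval ((1 - 2 * (k : ℂ)) / 4) *
          (ascPochhammer ℂ n).eval ((3 - 2 * (k : ℂ)) / 4)) * (3 / 4 * (1 - (c : ℂ))) ^ n /
        n.factorial) := by
  rw [leftTerm, genHypergeometric, ← Finset.mul_sum]
  congr 1
  simp only [List.map_cons, List.map_nil, List.prod_cons, List.prod_nil, mul_one]
  refine tsum_eq_sum fun n hn => ?_
  have hk : k < 2 * n := by
    rw [Finset.mem_range] at hn
    omega
  have h := ascPochhammer_half_neg_eq_zero hk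
  rw [← mul_assoc, h]
  simp

lemma conj_Gamma_odd (N : ℤ) : (starRingEnd ℂ) (Gamma ((2 * (N : ℂ) + 1) / 6)) =
    Gamma ((2 * (N : ℂ) + 1) / 6) := by
  rw [← Gamma_conj]
  simp [map_ofNat (starRingEnd ℂ)]

/-- Conjugation sends 2iz to -2iz, so both rays carry the same coefficient. Since i = τ³, the powers
of τ collect to ±(2(m + 2n) - 1), which depends only on the weight k = m + 2n. -/
lemma right_bracket (q z : ℝ) (m n : ℕ) :
    sexticUnit⁻¹ * ((I * (-2 * z : ℝ) * sexticUnit ^ 2) ^ m / m.factorial *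
        ((I * q * sexticUnit) ^ n / n.factorial) *
      (Gamma ((2 * ((2 * m + n : ℕ) : ℂ) + 1) / 6) / 6)) +
    (starRingEnd ℂ) (sexticUnit⁻¹ * ((I * (2 * z : ℝ) * sexticUnit ^ 2) ^ m / m.factorial *
        ((I * q * sexticUnit) ^ n / n.factorial) *
      (Gamma ((2 * ((2 * m + n : ℕ) : ℂ) + 1) / 6) / 6))) =
    (-2 * I * z) ^ m * q ^ n / (m.factorial * n.factorial) *
      (Gamma ((2 * ((2 * m + n : ℕ) : ℂ) + 1) / 6) / 6) *
      (sexticUnit ^ (2 * ((m + 2 * n : ℕ) : ℤ) - 1) +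
        sexticUnit ^ (-(2 * ((m + 2 * n : ℕ) : ℤ) - 1))) := by
  have hG := conj_Gamma_odd (2 * m + n : ℕ)
  rw [Int.cast_natCast] at hG
  have hw := sexticUnit_ne_zero
  have hI : I = sexticUnit ^ 3 := sexticUnit_pow_three.symm
  have hI' : -I = (sexticUnit ^ 3)⁻¹ := by rw [sexticUnit_pow_three, inv_I]
  have e1 : (I * q * sexticUnit) ^ n = q ^ n * sexticUnit ^ (4 * n : ℤ) := by
    rw [show (4 * n : ℤ) = ((4 * n : ℕ) : ℤ) by push_cast; ring, zpow_natCast, pow_mul, ← mul_pow]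
    congr 1
    rw [hI]
    ring
  have e2 : (starRingEnd ℂ) ((I * q * sexticUnit) ^ n) = q ^ n * sexticUnit ^ (-(4 * n) : ℤ) := by
    rw [show (-(4 * n) : ℤ) = -((4 * n : ℕ) : ℤ) by push_cast; ring, zpow_neg, zpow_natCast,
      pow_mul, ← inv_pow, ← mul_pow, map_pow]
    congr 1
    rw [map_mul, map_mul, conj_I, conj_ofReal, conj_sexticUnit, hI']
    field_simp
  have e3 : (I * (-2 * z : ℝ) * sexticUnit ^ 2) ^ m =
      (-2 * I * z) ^ m * sexticUnit ^ (2 * m : ℤ) := by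
    rw [show (2 * m : ℤ) = ((2 * m : ℕ) : ℤ) by push_cast; ring, zpow_natCast, pow_mul, ← mul_pow]
    congr 1
    push_cast
    ring
  have e4 : (starRingEnd ℂ) ((I * (2 * z : ℝ) * sexticUnit ^ 2) ^ m) =
      (-2 * I * z) ^ m * sexticUnit ^ (-(2 * m) : ℤ) := by
    rw [show (-(2 * m) : ℤ) = -((2 * m : ℕ) : ℤ) by push_cast; ring, zpow_neg, zpow_natCast,
      pow_mul, ← inv_pow, ← mul_pow, map_pow]
    congr 1
    rw [map_mul, map_mul, conj_I, conj_ofReal, map_pow, conj_sexticUnit]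
    push_cast
    ring
  simp only [map_mul (starRingEnd ℂ), map_div₀, map_inv₀, hG, e2, e4, conj_sexticUnit,
    map_natCast, map_ofNat, inv_inv]
  rw [e1, e3]
  rw [show (2 * ((m + 2 * n : ℕ) : ℤ) - 1) = -1 + 2 * m + 4 * n by push_cast; ring,
    show (-(-1 + 2 * m + 4 * n) : ℤ) = 1 + -(2 * m) + -(4 * n) by ring,
    zpow_add₀ hw, zpow_add₀ hw, zpow_add₀ hw, zpow_add₀ hw, zpow_one, zpow_neg_one]
  ring

/-- With i = τ³ the exponents are ±(1 + 4j - 4n), congruent modulo 12 to ±(4k + 1) for k = j + 2n;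
again only the weight remains. -/
lemma left_bracket (r z : ℝ) (j n : ℕ) (G : ℂ) (hG : (starRingEnd ℂ) G = G)
    (P : ℂ) (hP : (starRingEnd ℂ) P = P) :
    sexticUnit⁻¹ * (((-2 * z : ℝ) / 3 : ℂ) ^ j / j.factorial * ((I * r) ^ n / n.factorial) *
      (P * sexticUnit ^ ((n : ℤ) - j) * G)) +
    (starRingEnd ℂ) (sexticUnit⁻¹ * (((2 * z : ℝ) / 3 : ℂ) ^ j / j.factorial *
      ((I * r) ^ n / n.factorial) * (P * sexticUnit ^ ((n : ℤ) - j) * G))) =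
    (-(2 / 3 * I * z)) ^ j * r ^ n / (j.factorial * n.factorial) * (P * G) *
      (sexticUnit ^ (4 * ((j + 2 * n : ℕ) : ℤ) + 1) +
        sexticUnit ^ (-(4 * ((j + 2 * n : ℕ) : ℤ) + 1))) := by
  have hw := sexticUnit_ne_zero
  have hI : I = sexticUnit ^ 3 := sexticUnit_pow_three.symm
  have hI' : -I = (sexticUnit ^ 3)⁻¹ := by rw [sexticUnit_pow_three, inv_I]
  have e1 : (I * r) ^ n = r ^ n * sexticUnit ^ (3 * n : ℤ) := by
    rw [show (3 * n : ℤ) = ((3 * n : ℕ) : ℤ) by push_cast; ring, zpow_natCast, pow_mul, ← mul_pow,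
      sexticUnit_pow_three]
    ring
  have e2 : (starRingEnd ℂ) ((I * r) ^ n) = r ^ n * sexticUnit ^ (-(3 * n) : ℤ) := by
    rw [show (-(3 * n) : ℤ) = -((3 * n : ℕ) : ℤ) by push_cast; ring, zpow_neg, zpow_natCast,
      pow_mul, ← inv_pow, ← mul_pow, map_pow, ← hI', map_mul, conj_I, conj_ofReal]
    ring
  have e3 : ((-2 * z : ℝ) / 3 : ℂ) ^ j =
      (-(2 / 3 * I * z)) ^ j * sexticUnit ^ (-(3 * j) : ℤ) := by
    rw [show (-(3 * j) : ℤ) = -((3 * j : ℕ) : ℤ) by push_cast; ring, zpow_neg, zpow_natCast,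
      pow_mul, ← inv_pow, ← mul_pow, ← hI']
    congr 1
    push_cast
    linear_combination -(2 / 3 * (z : ℂ)) * I_sq
  have e4 : (starRingEnd ℂ) (((2 * z : ℝ) / 3 : ℂ) ^ j) =
      (-(2 / 3 * I * z)) ^ j * sexticUnit ^ (3 * j : ℤ) := by
    rw [show (3 * j : ℤ) = ((3 * j : ℕ) : ℤ) by push_cast; ring, zpow_natCast, pow_mul,
      ← mul_pow, sexticUnit_pow_three, map_pow, map_div₀, conj_ofReal, map_ofNat]
    congr 1
    push_cast
    linear_combination (2 / 3 * (z : ℂ)) * I_sq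
  have e5 : (starRingEnd ℂ) (sexticUnit ^ ((n : ℤ) - j)) = sexticUnit ^ (-((n : ℤ) - j)) := by
    rw [map_zpow₀, conj_sexticUnit, inv_zpow, zpow_neg]
  simp only [map_mul (starRingEnd ℂ), map_div₀ (starRingEnd ℂ), map_inv₀, hG, hP, e2, e4, e5,
    conj_sexticUnit, map_natCast, inv_inv]
  rw [e1, e3]
  have e6 : (4 * ((j + 2 * n : ℕ) : ℤ) + 1) = (1 + 3 * j + -(3 * n) + -((n : ℤ) - j)) + 6 * (2 * n) := by
    push_cast
    ring
  have e7 : -(4 * ((j + 2 * n : ℕ) : ℤ) + 1) =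
      (-1 + -(3 * j) + 3 * n + ((n : ℤ) - j)) + 6 * (2 * -n) := by
    push_cast
    ring
  rw [e7, e6, sexticUnit_zpow_add_six_mul, sexticUnit_zpow_add_six_mul, zpow_mul (-1 : ℂ),
    zpow_mul (-1 : ℂ), show (-1 : ℂ) ^ (2 : ℤ) = 1 by norm_num, one_zpow, one_zpow]
  simp only [zpow_add₀ hw, zpow_one, zpow_neg_one]
  ring

/-- Reflection sends the argument to (5-4k)/6 + n, whose Gamma value splits off a Pochhammer symbol.
The sine, equal to (-1)ⁿ times the one in `unit_identity_right`, cancels. -/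
lemma right_Gamma (k n : ℕ) :
    Gamma ((2 * (2 * (k : ℂ) - 3 * n) + 1) / 6) *
      (sexticUnit ^ (2 * (k : ℤ) - 1) + sexticUnit ^ (-(2 * (k : ℤ) - 1))) =
    4 * Real.pi * (-1) ^ k * (-1) ^ n * ((omegaRoot ^ (k + 1)).im : ℂ) /
      (Gamma ((5 - 4 * (k : ℂ)) / 6) * (ascPochhammer ℂ n).eval ((5 - 4 * (k : ℂ)) / 6)) := by
  have hx := ne_neg_nat_of_odd_div (d := 6) (N := 2 * (2 * k - 3 * n) + 1)
    (x := (2 * (2 * (k : ℂ) - 3 * n) + 1) / 6) (by decide) ⟨_, rfl⟩ (by push_cast; ring)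
  have hc := ne_neg_nat_of_odd_div (d := 6) (N := 2 * (2 - 2 * k) + 1)
    (x := (5 - 4 * (k : ℂ)) / 6) (by decide) ⟨_, rfl⟩ (by push_cast; ring)
  have hx' := ne_neg_nat_of_odd_div (d := 6) (N := 2 * (2 - 2 * k + 3 * n) + 1)
    (x := 1 - (2 * (2 * (k : ℂ) - 3 * n) + 1) / 6) (by decide) ⟨_, rfl⟩ (by push_cast; ring)
  obtain ⟨hs, hG⟩ := Gamma_eq_pi_div hx hx'
  have hsin : sin (Real.pi * ((2 * (2 * (k : ℂ) - 3 * n) + 1) / 6)) =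
      (-1) ^ n * sin (Real.pi * (((4 * k + 1 : ℤ) : ℂ) / 6)) := by
    rw [show (Real.pi : ℂ) * ((2 * (2 * (k : ℂ) - 3 * n) + 1) / 6) =
      Real.pi * (((4 * k + 1 : ℤ) : ℂ) / 6) - n * Real.pi by push_cast; ring]
    exact (Complex.sin_antiperiodic.sub_nat_mul_eq n).trans (by simp)
  have h1 : 1 - (2 * (2 * (k : ℂ) - 3 * n) + 1) / 6 = (5 - 4 * (k : ℂ)) / 6 + n := by ring
  rw [hsin] at hs
  rw [hG, hsin, h1, Gamma_add_nat hc]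
  have hs2 := right_ne_zero_of_mul hs
  have hn : ((-1 : ℂ) ^ n) ^ 2 = 1 := by rw [← pow_mul, mul_comm, pow_mul]; norm_num
  have hk : ((-1 : ℂ) ^ k) ^ 2 = 1 := by rw [← pow_mul, mul_comm, pow_mul]; norm_num
  have hu := unit_identity_right k
  have hn0 : (-1 : ℂ) ^ n ≠ 0 := pow_ne_zero _ (by norm_num)
  have hg0 := Gamma_ne_zero hc
  have hp0 := ascPochhammer_ne_zero_of_ne_neg hc n
  have hW : sexticUnit ^ (2 * (k : ℤ) - 1) + sexticUnit ^ (-(2 * (k : ℤ) - 1)) = (-1) ^ k *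
      (4 * ((omegaRoot ^ (k + 1)).im : ℂ) * sin (Real.pi * (((4 * k + 1 : ℤ) : ℂ) / 6))) := by
    rw [← hu, ← mul_assoc, ← sq, hk, one_mul]
  rw [hW]
  generalize sin (Real.pi * (((4 * k + 1 : ℤ) : ℂ) / 6)) = S at hs2 ⊢
  field_simp
  rw [hn, one_mul]

/-- Here the Pochhammer symbol is split off before reflecting, so it ends in the numerator and
becomes the third upper parameter of the ₃F₂. -/
lemma left_Gamma (k n : ℕ) :
    Gamma ((2 * (3 * (n : ℂ) - k) + 1) / 6) *
      (sexticUnit ^ (4 * (k : ℤ) + 1) + sexticUnit ^ (-(4 * (k : ℤ) + 1))) =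
    4 * Real.pi * (-1) ^ k * ((omegaRoot ^ (k + 1)).im : ℂ) *
      (ascPochhammer ℂ n).eval ((1 - 2 * (k : ℂ)) / 6) / Gamma ((5 + 2 * (k : ℂ)) / 6) := by
  have hx := ne_neg_nat_of_odd_div (d := 6) (N := 2 * (-k) + 1)
    (x := (1 - 2 * (k : ℂ)) / 6) (by decide) ⟨_, rfl⟩ (by push_cast; ring)
  have hx' := ne_neg_nat_of_odd_div (d := 6) (N := 2 * (k + 2) + 1)
    (x := 1 - (1 - 2 * (k : ℂ)) / 6) (by decide) ⟨_, rfl⟩ (by push_cast; ring)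
  obtain ⟨hs, hG⟩ := Gamma_eq_pi_div hx hx'
  have h1 : 1 - (1 - 2 * (k : ℂ)) / 6 = (5 + 2 * (k : ℂ)) / 6 := by ring
  have h2 : (2 * (3 * (n : ℂ) - k) + 1) / 6 = (1 - 2 * (k : ℂ)) / 6 + n := by ring
  have h3 : (((1 - 2 * k : ℤ) : ℂ) / 6) = (1 - 2 * (k : ℂ)) / 6 := by push_cast; ring
  have hk : ((-1 : ℂ) ^ k) ^ 2 = 1 := by rw [← pow_mul, mul_comm, pow_mul]; norm_num
  have hW : sexticUnit ^ (4 * (k : ℤ) + 1) + sexticUnit ^ (-(4 * (k : ℤ) + 1)) = (-1) ^ k *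
      (4 * ((omegaRoot ^ (k + 1)).im : ℂ) * sin (Real.pi * ((1 - 2 * (k : ℂ)) / 6))) := by
    rw [← h3, ← unit_identity_left, ← mul_assoc, ← sq, hk, one_mul]
  have hg0 := Gamma_ne_zero hx'
  rw [h1] at hg0 hG
  rw [h2, Gamma_add_nat hx, hG, hW]
  generalize sin (Real.pi * ((1 - 2 * (k : ℂ)) / 6)) = S at hs ⊢
  field_simp

/-- The field identity behind `right_coeff`, with every special value replaced by a variable tied to
the others only by the displayed relations. -/
lemma right_coeff_algebra {ρ π' A A' Q Z C Zk Fm Fn Fk Γ₁ Γ₂ P₁ P₂ P₃ W J σ ν f : ℂ}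
    (hG : Γ₁ * W = 4 * π' * σ * ν * J / (Γ₂ * P₁)) (hA : A = σ * A') (hσ : σ * σ = 1)
    (hQ : Q = C * Z) (hZ : Zk = A' * (ν * f * Z)) (hP : P₂ * P₃ = Fk / (f * Fm))
    (hπ : π' ≠ 0) (hf : f ≠ 0) (hk : Fk ≠ 0) :
    1 / (2 * π') * (2 * (ρ * (A * Q / (Fm * Fn) * (Γ₁ / 6) * W))) =
      2 / 3 * ρ * (J * Zk / (Γ₂ * Fk) * (Fn⁻¹ * P₂ * P₃ * P₁⁻¹ * C)) := by
  have e1 : Fm⁻¹ = Fk / (f * Fm) * f / Fk := by field_simp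
  have e2 : Γ₁ * W / π' = 4 * σ * ν * J / (Γ₂ * P₁) := by
    rw [hG, div_right_comm]
    congr 1
    field_simp
  calc _ = ρ / 6 * (A * Q / (Fm * Fn)) * (Γ₁ * W / π') := by ring
    _ = ρ * (2 / 3) * (J * A' * ν * Z * C / (Γ₂ * P₁ * Fn)) * Fm⁻¹ * (σ * σ) := by
        rw [e2, hA, hQ]
        ring
    _ = _ := by
        rw [hσ, e1, ← hP, hZ]
        ring

lemma left_coeff_algebra {ρ π' A A' Q Z C Zk Fm Fn Fk Γ₁ Γ₂ P₁ P₂ P₃ P₄ P₅ P₆ H W J σ f : ℂ}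
    (hG : Γ₁ * W = 4 * π' * σ * J * P₁ / Γ₂) (hA : A = σ * A') (hσ : σ * σ = 1)
    (hQ : Q = C * Z) (hZ : Zk = A' * Z) (hP : P₂ * P₃ = Fk / (f * Fm))
    (hH : H = P₆ * (f * (P₄ * P₅))) (h4 : P₄ ≠ 0) (h5 : P₅ ≠ 0)
    (hπ : π' ≠ 0) (hf : f ≠ 0) (hk : Fk ≠ 0) :
    1 / (2 * π') * (2 * (ρ * (A * Q / (Fm * Fn) * (P₆ * (Γ₁ / 6)) * W))) =
      2 / 3 * ρ * (J * (H * Zk) / (Γ₂ * Fk) * (P₂ * (P₃ * P₁) / (P₄ * P₅) * C / Fn)) := by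
  have e1 : Fm⁻¹ = Fk / (f * Fm) * f / Fk := by field_simp
  have e2 : Γ₁ * W / π' = 4 * σ * J * P₁ / Γ₂ := by
    rw [hG, div_right_comm]
    congr 1
    field_simp
  have e3 : P₄ * P₅ / (P₄ * P₅) = 1 := div_self (mul_ne_zero h4 h5)
  calc _ = ρ / 6 * (A * Q / (Fm * Fn)) * P₆ * (Γ₁ * W / π') := by ring
    _ = ρ * (2 / 3) * (J * A' * Z * C * P₁ * P₆ / (Γ₂ * Fn)) * Fm⁻¹ * (σ * σ) *
        (P₄ * P₅ / (P₄ * P₅)) := by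
        rw [e2, hA, hQ, e3]
        ring
    _ = _ := by
        rw [hσ, e1, ← hP, hZ, hH]
        ring

lemma rootRatio_eq : 2 / 3 * (rootRatio : ℂ) =
    2 * (Real.sqrt Real.pi : ℂ) / (3 * (Real.sqrt 3 : ℂ)) := by
  rw [rootRatio]
  push_cast
  ring

lemma right_coeff (c z : ℝ) (m n : ℕ) :
    1 / (2 * (Real.pi : ℂ)) * (2 * (rootRatio * ((-2 * I * z) ^ m * ((z ^ 2 - c * z ^ 2 : ℝ) : ℂ) ^ n /
      (m.factorial * n.factorial) * (Gamma ((2 * ((2 * m + n : ℕ) : ℂ) + 1) / 6) / 6) *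
      (sexticUnit ^ (2 * ((m + 2 * n : ℕ) : ℤ) - 1) +
        sexticUnit ^ (-(2 * ((m + 2 * n : ℕ) : ℤ) - 1)))))) =
    2 * (Real.sqrt Real.pi : ℂ) / (3 * (Real.sqrt 3 : ℂ)) *
      (((omegaRoot ^ (m + 2 * n + 1)).im : ℂ) * (2 * I * (z : ℂ)) ^ (m + 2 * n) /
      (Gamma ((5 - 4 * ((m + 2 * n : ℕ) : ℂ)) / 6) * ((m + 2 * n).factorial : ℂ)) *
      ((n.factorial : ℂ)⁻¹ * (ascPochhammer ℂ n).eval (-((m + 2 * n : ℕ) : ℂ) / 2) *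
        (ascPochhammer ℂ n).eval ((1 - ((m + 2 * n : ℕ) : ℂ)) / 2) *
        ((ascPochhammer ℂ n).eval ((5 - 4 * ((m + 2 * n : ℕ) : ℂ)) / 6))⁻¹ *
        (1 - (c : ℂ)) ^ n)) := by
  have hG := right_Gamma (m + 2 * n) n
  have hP := ascPochhammer_half_neg (show 2 * n ≤ m + 2 * n by omega)
  rw [Nat.add_sub_cancel] at hP
  have harg : (2 * (2 * ((m + 2 * n : ℕ) : ℂ) - 3 * n) + 1) / 6 =
      (2 * ((2 * m + n : ℕ) : ℂ) + 1) / 6 := by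
    push_cast
    ring
  rw [harg] at hG
  have hf : ((m + 2 * n).factorial : ℂ) ≠ 0 := by exact_mod_cast Nat.factorial_ne_zero _
  have hpi : (Real.pi : ℂ) ≠ 0 := ofReal_ne_zero.2 Real.pi_ne_zero
  have hq : ((z ^ 2 - c * z ^ 2 : ℝ) : ℂ) ^ n = (1 - (c : ℂ)) ^ n * (z ^ 2 : ℂ) ^ n := by
    rw [← mul_pow]
    push_cast
    ring
  have hz : (2 * I * (z : ℂ)) ^ (m + 2 * n) = (2 * I * z) ^ m * ((-1) ^ n * 4 ^ n * (z ^ 2 : ℂ) ^ n) := by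
    rw [pow_add, pow_mul, ← mul_pow, ← mul_pow]
    congr 2
    linear_combination 4 * (z : ℂ) ^ 2 * I_sq
  have hs : (-2 * I * (z : ℂ)) ^ m = (-1) ^ m * (2 * I * z) ^ m := by
    rw [← mul_pow]
    ring
  have hm : ((-1 : ℂ) ^ m) * (-1) ^ m = 1 := by rw [← mul_pow]; norm_num
  have hk : (-1 : ℂ) ^ (m + 2 * n) = (-1) ^ m := by rw [pow_add, pow_mul]; norm_num
  rw [hk] at hG
  have h4 : (4 : ℂ) ^ n ≠ 0 := pow_ne_zero _ (by norm_num)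
  rw [← rootRatio_eq]
  exact right_coeff_algebra hG hs hm hq hz hP hpi h4 hf

lemma left_coeff (c z : ℝ) (j n : ℕ) :
    1 / (2 * (Real.pi : ℂ)) * (2 * (rootRatio * ((-(2 / 3 * I * z)) ^ j *
      ((-((1 - c) * z ^ 2 / 3) : ℝ) : ℂ) ^ n / (j.factorial * n.factorial) *
      ((ascPochhammer ℂ j).eval (1 / 2) * (Gamma ((2 * (((n : ℤ) - j : ℤ) : ℂ) + 1) / 6) / 6)) *
      (sexticUnit ^ (4 * ((j + 2 * n : ℕ) : ℤ) + 1) +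
        sexticUnit ^ (-(4 * ((j + 2 * n : ℕ) : ℤ) + 1)))))) =
    2 * (Real.sqrt Real.pi : ℂ) / (3 * (Real.sqrt 3 : ℂ)) *
      (((omegaRoot ^ (j + 2 * n + 1)).im : ℂ) *
      ((ascPochhammer ℂ (j + 2 * n)).eval (1 / 2) * (2 / 3 * I * (z : ℂ)) ^ (j + 2 * n)) /
      (Gamma ((5 + 2 * ((j + 2 * n : ℕ) : ℂ)) / 6) * ((j + 2 * n).factorial : ℂ)) *
      ((ascPochhammer ℂ n).eval (-((j + 2 * n : ℕ) : ℂ) / 2) *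
        ((ascPochhammer ℂ n).eval ((1 - ((j + 2 * n : ℕ) : ℂ)) / 2) *
        (ascPochhammer ℂ n).eval ((1 - 2 * ((j + 2 * n : ℕ) : ℂ)) / 6)) /
        ((ascPochhammer ℂ n).eval ((1 - 2 * ((j + 2 * n : ℕ) : ℂ)) / 4) *
          (ascPochhammer ℂ n).eval ((3 - 2 * ((j + 2 * n : ℕ) : ℂ)) / 4)) *
          (3 / 4 * (1 - (c : ℂ))) ^ n / n.factorial)) := by
  have hG := left_Gamma (j + 2 * n) n
  have hP := ascPochhammer_half_neg (show 2 * n ≤ j + 2 * n by omega)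
  rw [Nat.add_sub_cancel] at hP
  have harg : (2 * (3 * (n : ℂ) - ((j + 2 * n : ℕ) : ℂ)) + 1) / 6 =
      (2 * (((n : ℤ) - j : ℤ) : ℂ) + 1) / 6 := by
    push_cast
    ring
  have hH := ascPochhammer_one_half_add j (2 * n)
  have hD := ascPochhammer_two_mul n ((1 - 2 * ((j + 2 * n : ℕ) : ℂ)) / 4)
  rw [show 2 * ((1 - 2 * ((j + 2 * n : ℕ) : ℂ)) / 4) = 1 / 2 - ((j + 2 * n : ℕ) : ℂ) by ring,
    show (1 - 2 * ((j + 2 * n : ℕ) : ℂ)) / 4 + 1 / 2 = (3 - 2 * ((j + 2 * n : ℕ) : ℂ)) / 4 by ring]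
    at hD
  rw [hD, pow_mul, neg_one_sq, one_pow, one_mul] at hH
  have hl1 := ascPochhammer_ne_zero_of_ne_neg (ne_neg_nat_of_odd_div (d := 4)
    (N := 2 * (-(j + 2 * n)) + 1) (x := (1 - 2 * ((j + 2 * n : ℕ) : ℂ)) / 4) (by decide) ⟨_, rfl⟩
    (by push_cast; ring)) n
  have hl2 := ascPochhammer_ne_zero_of_ne_neg (ne_neg_nat_of_odd_div (d := 4)
    (N := 2 * (1 - (j + 2 * n)) + 1) (x := (3 - 2 * ((j + 2 * n : ℕ) : ℂ)) / 4) (by decide) ⟨_, rfl⟩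
    (by push_cast; ring)) n
  rw [harg] at hG
  have hf : ((j + 2 * n).factorial : ℂ) ≠ 0 := by exact_mod_cast Nat.factorial_ne_zero _
  have hpi : (Real.pi : ℂ) ≠ 0 := ofReal_ne_zero.2 Real.pi_ne_zero
  have hq : ((-((1 - c) * z ^ 2 / 3) : ℝ) : ℂ) ^ n =
      (3 / 4 * (1 - (c : ℂ))) ^ n * ((-4 / 9) ^ n * (z ^ 2 : ℂ) ^ n) := by
    rw [← mul_pow, ← mul_pow]
    push_cast
    ring
  have hz : (2 / 3 * I * (z : ℂ)) ^ (j + 2 * n) =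
      (2 / 3 * I * z) ^ j * ((-4 / 9) ^ n * (z ^ 2 : ℂ) ^ n) := by
    rw [pow_add, pow_mul, ← mul_pow]
    congr 2
    linear_combination 4 / 9 * (z : ℂ) ^ 2 * I_sq
  have hs : (-(2 / 3 * I * (z : ℂ))) ^ j = (-1) ^ j * (2 / 3 * I * z) ^ j := by
    rw [← mul_pow]
    ring
  have hm : ((-1 : ℂ) ^ j) * (-1) ^ j = 1 := by rw [← mul_pow]; norm_num
  have hk : (-1 : ℂ) ^ (j + 2 * n) = (-1) ^ j := by rw [pow_add, pow_mul]; norm_num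
  rw [hk] at hG
  have h4 : (4 : ℂ) ^ n ≠ 0 := pow_ne_zero _ (by norm_num)
  rw [← rootRatio_eq]
  exact left_coeff_algebra hG hs hm hq hz hP hH hl1 hl2 hpi h4 hf

/-! ### The two series for E. -/

/-- The value of the umbilic integral without its phase factor. -/
noncomputable def reducedValue (x z : ℝ) : ℂ :=
  1 / (2 * (Real.pi : ℂ)) * (2 * (rootRatio *
    (sexticUnit⁻¹ * rayIntegral (-2 * z) (z ^ 2 - x) +
      (starRingEnd ℂ) (sexticUnit⁻¹ * rayIntegral (2 * z) (z ^ 2 - x)))))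

lemma umbilicValue_eq (x z : ℝ) : umbilicValue x z = shiftPhase x z * reducedValue x z := by
  rw [umbilicValue, reducedValue]
  change 1 / (2 * (Real.pi : ℂ)) * (shiftPhase x z * (2 *
    ((rootRatio : ℂ) * sexticUnit⁻¹ * rayIntegral (-2 * z) (z ^ 2 - x) + (starRingEnd ℂ)
      ((rootRatio : ℂ) * sexticUnit⁻¹ * rayIntegral (2 * z) (z ^ 2 - x))))) = _
  rw [mul_assoc (rootRatio : ℂ), mul_assoc (rootRatio : ℂ), map_mul (starRingEnd ℂ) (rootRatio : ℂ),
    conj_ofReal]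
  ring

lemma rootRatio_ne_zero : 2 * (Real.sqrt Real.pi : ℂ) / (3 * (Real.sqrt 3 : ℂ)) ≠ 0 := by
  have h1 : Real.sqrt Real.pi ≠ 0 := (Real.sqrt_pos.2 Real.pi_pos).ne'
  have h2 : Real.sqrt 3 ≠ 0 := (Real.sqrt_pos.2 (by norm_num)).ne'
  have h3 : (Real.sqrt Real.pi : ℂ) ≠ 0 := ofReal_ne_zero.2 h1
  have h4 : (Real.sqrt 3 : ℂ) ≠ 0 := ofReal_ne_zero.2 h2
  simp [h3, h4]

/-- With p = ∓2z and q = (1-c)z² the (m, n) term has degree m + 2n in z, hence the regrouping by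
that weight. -/
lemma hasSum_rightTerm (c z : ℝ) : HasSum (fun k => 2 * (Real.sqrt Real.pi : ℂ) /
    (3 * (Real.sqrt 3 : ℂ)) * rightTerm c z k) (reducedValue (c * z ^ 2) z) := by
  have h1 := (hasSum_rayIntegral (-2 * z) (z ^ 2 - c * z ^ 2)).mul_left sexticUnit⁻¹
  have h2 := hasSum_conj'.2
    ((hasSum_rayIntegral (2 * z) (z ^ 2 - c * z ^ 2)).mul_left sexticUnit⁻¹)
  have h := ((((h1.add h2).mul_left (rootRatio : ℂ)).mul_left 2).mul_left
    (1 / (2 * (Real.pi : ℂ)))).regroup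
  refine (congrArg (fun g => HasSum g _) (funext fun k => ?_)).mp h
  rw [rightTerm_eq_sum, Finset.mul_sum]
  refine Finset.sum_congr rfl fun n hn => ?_
  obtain ⟨m, rfl⟩ : ∃ m, k = m + 2 * n := ⟨k - 2 * n, by
    rw [Finset.mem_range] at hn
    omega⟩
  rw [Nat.add_sub_cancel, ← right_coeff, right_bracket]

lemma hasSum_leftTerm (c z : ℝ) : HasSum (fun k => 2 * (Real.sqrt Real.pi : ℂ) /
    (3 * (Real.sqrt 3 : ℂ)) * leftTerm c z k)
    (exp (I * ((-2 * z / 3 : ℂ) ^ 3 + -((1 - c) * z ^ 2 / 3) * (-2 * z / 3))) *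
      reducedValue (-(c * z ^ 2 / 3)) z) := by
  set q : ℝ := z ^ 2 - -(c * z ^ 2 / 3) with hq
  set r : ℝ := -((1 - c) * z ^ 2 / 3) with hr
  -- After completing the cube both rays have the same linear coefficient, since p² does not see the
  -- sign of p.
  have hr1 : ((q : ℂ) - ((-2 * z : ℝ) : ℂ) ^ 2 / 3) = (r : ℂ) := by
    rw [hq, hr]; push_cast; ring
  have hr2 : ((q : ℂ) - ((2 * z : ℝ) : ℂ) ^ 2 / 3) = (r : ℂ) := by
    rw [hq, hr]; push_cast; ring
  have h1 := (hasSum_rayIntegral_shifted (-2 * z) q).mul_left sexticUnit⁻¹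
  have h2 := hasSum_conj'.2 ((hasSum_rayIntegral_shifted (2 * z) q).mul_left sexticUnit⁻¹)
  rw [hr1] at h1
  rw [hr2] at h2
  have h := ((((h1.add h2).mul_left (rootRatio : ℂ)).mul_left 2).mul_left
    (1 / (2 * (Real.pi : ℂ)))).regroup
  have hval : 1 / (2 * (Real.pi : ℂ)) * (2 * (rootRatio *
      (sexticUnit⁻¹ * (exp (I * ((((-2 * z : ℝ) : ℂ) / 3) ^ 3 + r * (((-2 * z : ℝ) : ℂ) / 3))) *
        rayIntegral (-2 * z) q) + (starRingEnd ℂ) (sexticUnit⁻¹ *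
        (exp (I * ((((2 * z : ℝ) : ℂ) / 3) ^ 3 + r * (((2 * z : ℝ) : ℂ) / 3))) *
        rayIntegral (2 * z) q))))) =
      exp (I * ((-2 * z / 3 : ℂ) ^ 3 + -((1 - c) * z ^ 2 / 3) * (-2 * z / 3))) *
      reducedValue (-(c * z ^ 2 / 3)) z := by
    have e1 : exp (I * ((((-2 * z : ℝ) : ℂ) / 3) ^ 3 + r * (((-2 * z : ℝ) : ℂ) / 3))) =
        exp (I * ((-2 * z / 3 : ℂ) ^ 3 + -((1 - c) * z ^ 2 / 3) * (-2 * z / 3))) := by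
      rw [hr]; push_cast; rfl
    -- The completed-cube phase is odd in p, so conjugation of the factor for p = 2z gives the
    -- factor for p = -2z, and it comes out of the whole bracket.
    have e2 : (starRingEnd ℂ)
        (exp (I * ((((2 * z : ℝ) : ℂ) / 3) ^ 3 + r * (((2 * z : ℝ) : ℂ) / 3)))) =
        exp (I * ((-2 * z / 3 : ℂ) ^ 3 + -((1 - c) * z ^ 2 / 3) * (-2 * z / 3))) := by
      rw [← exp_conj, hr]
      congr 1
      simp only [map_mul, map_add, map_pow, map_div₀, conj_I, conj_ofReal, map_ofNat]
      push_cast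
      ring
    rw [e1, mul_left_comm sexticUnit⁻¹ (exp _), mul_left_comm sexticUnit⁻¹ (exp _),
      map_mul _ (exp _), e2, reducedValue, ← hq]
    ring
  rw [hval] at h
  refine (congrArg (fun g => HasSum g _) (funext fun k => ?_)).mp h
  rw [leftTerm_eq_sum, Finset.mul_sum]
  refine Finset.sum_congr rfl fun n hn => ?_
  obtain ⟨m, rfl⟩ : ∃ m, k = m + 2 * n := ⟨k - 2 * n, by
    rw [Finset.mem_range] at hn
    omega⟩
  have hG := conj_Gamma_odd ((n : ℤ) - m)
  have hG' : (starRingEnd ℂ) (Gamma ((2 * (((n : ℤ) - m : ℤ) : ℂ) + 1) / 6) / 6) =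
      Gamma ((2 * (((n : ℤ) - m : ℤ) : ℂ) + 1) / 6) / 6 := by
    rw [map_div₀, hG, map_ofNat]
  have hP : (starRingEnd ℂ) ((ascPochhammer ℂ m).eval (1 / 2)) =
      (ascPochhammer ℂ m).eval (1 / 2) := by
    clear hG hG' hn h h1 h2
    induction m with
    | zero => simp
    | succ m ih =>
      rw [ascPochhammer_succ_eval, map_mul, ih, map_add, map_div₀, map_one, map_ofNat, map_natCast]
  rw [Nat.add_sub_cancel, ← left_coeff, left_bracket r z m n _ hG' _ hP]

lemma right_formula (c z : ℝ) : Summable (rightTerm c z) ∧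
    ellipticUmbilic (c * z ^ 2) 0 z = rightPrefactor c z * ∑' k : ℕ, rightTerm c z k := by
  have h := hasSum_rightTerm c z
  have hs := (summable_mul_left_iff rootRatio_ne_zero).1 h.summable
  refine ⟨hs, ?_⟩
  rw [ellipticUmbilic_eq, umbilicValue_eq, ← h.tsum_eq, tsum_mul_left, rightPrefactor, shiftPhase]
  have e : I * (((c * z ^ 2 : ℝ) : ℂ) * z / 3 - 4 * (z : ℂ) ^ 3 / 27) =
      (9 * (c : ℂ) - 4) * (I * (z : ℂ) ^ 3 / 27) := by
    push_cast
    ring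
  rw [e]
  ring

lemma left_formula (c z : ℝ) : Summable (leftTerm c z) ∧
    ellipticUmbilic (-(c * z ^ 2 / 3)) 0 z = leftPrefactor c z * ∑' k : ℕ, leftTerm c z k := by
  have h := hasSum_leftTerm c z
  have hs := (summable_mul_left_iff rootRatio_ne_zero).1 h.summable
  refine ⟨hs, ?_⟩
  have ht := h.tsum_eq
  rw [tsum_mul_left] at ht
  rw [ellipticUmbilic_eq, umbilicValue_eq, leftPrefactor, mul_right_comm, ht, shiftPhase,
    mul_right_comm, ← exp_add]
  congr 2
  push_cast
  ring

/-! ### Terminating Gauss sums at argument 1. -/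

lemma ascPochhammer_add_eval (m n : ℕ) (x : ℂ) : (ascPochhammer ℂ (m + n)).eval x =
    (ascPochhammer ℂ m).eval x * (ascPochhammer ℂ n).eval (x + m) := by
  induction n with
  | zero => simp
  | succ n ih =>
    rw [← add_assoc, ascPochhammer_succ_eval, ascPochhammer_succ_eval, ih]
    push_cast
    ring

/-- The Chu–Vandermonde identity. -/
lemma chu_vandermonde (N : ℕ) : ∀ b c : ℂ, ∑ r ∈ Finset.HasAntidiagonal.antidiagonal N, (N.choose r.1 : ℂ) *
    ((-1) ^ r.1 * (ascPochhammer ℂ r.1).eval b * (ascPochhammer ℂ r.2).eval (c + r.1)) =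
    (ascPochhammer ℂ N).eval (c - b) := by
  induction N with
  | zero => intro b c; simp
  | succ N ih =>
    intro b c
    -- Pascal's rule splits the sum in two; by induction one part has the factor c + N and the other
    -- -b, which add to the new factor c - b + N.
    rw [Finset.sum_antidiagonal_choose_succ_mul (fun i j => (-1) ^ i *
      (ascPochhammer ℂ i).eval b * (ascPochhammer ℂ j).eval (c + i)), ascPochhammer_succ_eval]
    have h1 : ∑ r ∈ Finset.HasAntidiagonal.antidiagonal N, (N.choose r.1 : ℂ) * ((-1) ^ r.1 *
        (ascPochhammer ℂ r.1).eval b * (ascPochhammer ℂ (r.2 + 1)).eval (c + r.1)) =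
        (ascPochhammer ℂ N).eval (c - b) * (c + N) := by
      rw [← ih b c, Finset.sum_mul]
      refine Finset.sum_congr rfl fun r hr => ?_
      have hN : (N : ℂ) = r.1 + r.2 := by
        rw [← Finset.HasAntidiagonal.mem_antidiagonal.1 hr]
        push_cast
        rfl
      rw [ascPochhammer_succ_eval, hN]
      ring
    have h2 : ∑ r ∈ Finset.HasAntidiagonal.antidiagonal N, (N.choose r.2 : ℂ) * ((-1) ^ (r.1 + 1) *
        (ascPochhammer ℂ (r.1 + 1)).eval b * (ascPochhammer ℂ r.2).eval (c + (r.1 + 1 : ℕ))) =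
        -b * (ascPochhammer ℂ N).eval (c - b) := by
      rw [show c - b = (c + 1) - (b + 1) by ring, ← ih (b + 1) (c + 1), Finset.mul_sum]
      refine Finset.sum_congr rfl fun r hr => ?_
      rw [Nat.choose_symm_of_eq_add (Finset.HasAntidiagonal.mem_antidiagonal.1 hr).symm,
        ascPochhammer_succ_eval_left]
      push_cast
      rw [show c + ((r.1 : ℂ) + 1) = c + 1 + r.1 by ring]
      ring
    rw [h1, h2]
    ring

/-- Chu–Vandermonde divided by (c)_N, using (-N)_n/n! = (-1)ⁿ C(N, n) and (c)_N = (c)_n (c+n)_{N-n}.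
-/
lemma sum_hypergeometric_neg_nat (N : ℕ) (b : ℂ) {c : ℂ} (hc : ∀ k : ℕ, c ≠ -(k : ℂ)) :
    ∑ n ∈ Finset.range (N + 1), (n.factorial : ℂ)⁻¹ * (ascPochhammer ℂ n).eval (-(N : ℂ)) *
      (ascPochhammer ℂ n).eval b * ((ascPochhammer ℂ n).eval c)⁻¹ =
    (ascPochhammer ℂ N).eval (c - b) / (ascPochhammer ℂ N).eval c := by
  rw [← chu_vandermonde, Finset.sum_div,
    Finset.Nat.sum_antidiagonal_eq_sum_range_succ_mk]
  refine Finset.sum_congr rfl fun n hn => ?_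
  have hnN : n ≤ N := by
    rw [Finset.mem_range] at hn
    omega
  obtain ⟨m, rfl⟩ : ∃ m, N = n + m := ⟨N - n, by omega⟩
  have h1 := ascPochhammer_eval_neg_nat hnN
  have h2 := Nat.add_choose_mul_factorial_mul_factorial n m
  rw [← Nat.choose_symm_add] at h2
  rw [Nat.add_sub_cancel_left] at h1 ⊢
  have h3 : (((n + m).choose n : ℕ) : ℂ) * n.factorial * m.factorial = (n + m).factorial := by
    exact_mod_cast h2
  have hm : (m.factorial : ℂ) ≠ 0 := by exact_mod_cast Nat.factorial_ne_zero _
  have hn0 : (n.factorial : ℂ) ≠ 0 := by exact_mod_cast Nat.factorial_ne_zero _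
  have hp := ascPochhammer_ne_zero_of_ne_neg hc (n + m)
  rw [ascPochhammer_add_eval] at hp ⊢
  have hp1 := left_ne_zero_of_mul hp
  have hp2 := right_ne_zero_of_mul hp
  have h4 : (ascPochhammer ℂ n).eval (-((n + m : ℕ) : ℂ)) =
      (-1) ^ n * ((n + m).choose n : ℕ) * n.factorial := by
    apply mul_right_cancel₀ hm
    rw [h1, ← h3]
    ring
  rw [h4]
  generalize (ascPochhammer ℂ n).eval c = A at *
  generalize (ascPochhammer ℂ m).eval (c + n) = B at *
  generalize (ascPochhammer ℂ n).eval b = D at *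
  generalize (n.factorial : ℂ) = F at *
  generalize (((n + m).choose n : ℕ) : ℂ) = G at *
  field_simp

/-- The terminating Gauss series at `1`. -/
noncomputable def gaussSum₂ (k : ℕ) (c : ℂ) : ℂ := ∑ n ∈ Finset.range (k / 2 + 1),
  (n.factorial : ℂ)⁻¹ * (ascPochhammer ℂ n).eval (-(k : ℂ) / 2) *
    (ascPochhammer ℂ n).eval ((1 - (k : ℂ)) / 2) * ((ascPochhammer ℂ n).eval c)⁻¹

/-- For even k the terminating parameter is -k/2 = -N; in the odd case below it is (1-k)/2 = -N. -/
lemma gaussSum₂_even (N : ℕ) {c : ℂ} (hc : ∀ k : ℕ, c ≠ -(k : ℂ)) : gaussSum₂ (2 * N) c =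
    (ascPochhammer ℂ N).eval (c - (1 - 2 * N) / 2) / (ascPochhammer ℂ N).eval c := by
  rw [← sum_hypergeometric_neg_nat N _ hc, gaussSum₂, Nat.mul_div_cancel_left _ two_pos]
  refine Finset.sum_congr rfl fun n _ => ?_
  rw [show -((2 * N : ℕ) : ℂ) / 2 = -N by push_cast; ring]
  push_cast
  rfl

lemma gaussSum₂_odd (N : ℕ) {c : ℂ} (hc : ∀ k : ℕ, c ≠ -(k : ℂ)) : gaussSum₂ (2 * N + 1) c =
    (ascPochhammer ℂ N).eval (c + (2 * N + 1) / 2) / (ascPochhammer ℂ N).eval c := by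
  rw [show c + (2 * (N : ℂ) + 1) / 2 = c - (-(2 * N + 1) / 2) by ring,
    ← sum_hypergeometric_neg_nat N _ hc, gaussSum₂, show (2 * N + 1) / 2 = N by omega]
  refine Finset.sum_congr rfl fun n _ => ?_
  rw [show (1 - ((2 * N + 1 : ℕ) : ℂ)) / 2 = -N by push_cast; ring]
  push_cast
  ring

/-- The values `₂F₁(-k/2, (1-k)/2; (5-4k)/6 | 1) / Γ((5-4k)/6)`. -/
noncomputable def gaussValue (k : ℕ) : ℂ :=
  gaussSum₂ k ((5 - 4 * (k : ℂ)) / 6) / Gamma ((5 - 4 * (k : ℂ)) / 6)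

lemma right_lower_ne (k : ℤ) (j : ℕ) : (5 - 4 * (k : ℂ)) / 6 ≠ -(j : ℂ) :=
  ne_neg_nat_of_odd_div (d := 6) (N := 2 * (2 - 2 * k) + 1) (by decide) ⟨_, rfl⟩
    (by push_cast; ring) j

lemma gaussValue_even (N : ℕ) : gaussValue (2 * N) =
    (ascPochhammer ℂ N).eval ((1 - (N : ℂ)) / 3) / Gamma ((5 - 2 * (N : ℂ)) / 6) := by
  have hc := right_lower_ne (2 * N : ℕ)
  rw [Int.cast_natCast] at hc
  rw [gaussValue, gaussSum₂_even N hc, div_div, mul_comm (Polynomial.eval _ _), ← Gamma_add_nat hc]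
  congr 2
  · push_cast; ring
  · push_cast; ring

lemma gaussValue_odd (N : ℕ) : gaussValue (2 * N + 1) =
    (ascPochhammer ℂ N).eval ((2 - (N : ℂ)) / 3) / Gamma ((1 - 2 * (N : ℂ)) / 6) := by
  have hc := right_lower_ne (2 * N + 1 : ℕ)
  rw [Int.cast_natCast] at hc
  rw [gaussValue, gaussSum₂_odd N hc, div_div, mul_comm (Polynomial.eval _ _), ← Gamma_add_nat hc]
  congr 2
  · push_cast; ring
  · push_cast; ring

/-- A step of 3 exchanges the parities. From even to odd, the Pochhammer symbol keeps its base and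
gains one factor while the Gamma argument drops by 1. From odd to even, the Gamma value is unchanged
and the symbol gains a factor at each end. -/
lemma gaussValue_add_three (k : ℕ) :
    gaussValue (k + 3) = -(1 + (k : ℂ)) ^ 2 / 18 * gaussValue k := by
  obtain ⟨N, rfl | rfl⟩ := k.even_or_odd'
  · rw [show 2 * N + 3 = 2 * (N + 1) + 1 by ring, gaussValue_odd, gaussValue_even,
      ascPochhammer_succ_eval]
    have hx := ne_neg_nat_of_odd_div (d := 6) (N := 2 * (-N - 1) + 1)
      (x := (1 - 2 * ((N + 1 : ℕ) : ℂ)) / 6) (by decide) ⟨_, rfl⟩ (by push_cast; ring)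
    have h0 : (1 - 2 * ((N + 1 : ℕ) : ℂ)) / 6 ≠ 0 := by simpa using hx 0
    have hG := Gamma_add_one _ h0
    rw [show (1 - 2 * ((N + 1 : ℕ) : ℂ)) / 6 + 1 = (5 - 2 * (N : ℂ)) / 6 by push_cast; ring] at hG
    have hg := Gamma_ne_zero hx
    rw [hG]
    generalize Gamma ((1 - 2 * ((N + 1 : ℕ) : ℂ)) / 6) = G at *
    rw [show (2 - ((N + 1 : ℕ) : ℂ)) / 3 = (1 - (N : ℂ)) / 3 by push_cast; ring]
    generalize (ascPochhammer ℂ N).eval ((1 - (N : ℂ)) / 3) = A at *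
    have e : (1 - 2 * ((N + 1 : ℕ) : ℂ)) / 6 = -(1 + 2 * N) / 6 := by push_cast; ring
    rw [e] at h0 ⊢
    have h2 : (1 + 2 * (N : ℂ)) ≠ 0 := fun h => h0 (by rw [h]; simp)
    push_cast
    field_simp
    ring
  · rw [show 2 * N + 1 + 3 = 2 * (N + 2) by ring, gaussValue_odd, gaussValue_even,
      ascPochhammer_succ_eval_left, ascPochhammer_succ_eval,
      show (5 - 2 * ((N + 2 : ℕ) : ℂ)) / 6 = (1 - 2 * (N : ℂ)) / 6 by push_cast; ring,
      show (1 - ((N + 2 : ℕ) : ℂ)) / 3 + 1 = (2 - (N : ℂ)) / 3 by push_cast; ring]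
    push_cast
    ring

lemma rightTerm_zero (z : ℝ) (k : ℕ) : rightTerm 0 z k =
    ((omegaRoot ^ (k + 1)).im : ℂ) * ((2 * I * (z : ℂ)) ^ k / k.factorial * gaussValue k) := by
  rw [rightTerm_eq_sum, ← Finset.mul_sum, gaussValue, gaussSum₂]
  simp only [ofReal_zero, sub_zero, one_pow, mul_one]
  ring

/-! ### Kummer's transformation and the Berry–Howls formula. -/

/-- Kummer's second transformation. -/
lemma kummer_second {a : ℝ} (ha : 0 < a) (x : ℂ) : HasSum (fun k : ℕ =>
    (ascPochhammer ℂ k).eval (a : ℂ) / ((ascPochhammer ℂ k).eval (2 * a : ℂ) * k.factorial) *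
      (2 * x) ^ k) (exp x * genHypergeometric [] [(a + 1 / 2 : ℂ)] (x ^ 2 / 4)) := by
  have hpos : ∀ (y : ℝ) (n : ℕ), 0 < y → y ^ n ≤ ‖(ascPochhammer ℂ n).eval (y : ℂ)‖ := by
    intro y n hy
    induction n with
    | zero => simp
    | succ n ih =>
      rw [ascPochhammer_succ_eval, norm_mul, pow_succ, ← ofReal_natCast, ← ofReal_add, norm_real,
        Real.norm_of_nonneg (by positivity)]
      have : (0 : ℝ) ≤ n := n.cast_nonneg
      gcongr
      linarith
  have hne : ∀ y : ℝ, 0 < y → ∀ k : ℕ, (y : ℂ) ≠ -(k : ℂ) := by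
    intro y hy k h
    have h2 : y = -(k : ℝ) := by exact_mod_cast h
    have : (0 : ℝ) ≤ k := k.cast_nonneg
    linarith
  set c : ℂ := a + 1 / 2 with hc
  have hcr : c = ((a + 1 / 2 : ℝ) : ℂ) := by rw [hc]; push_cast; rfl
  have hcne : ∀ k : ℕ, c ≠ -(k : ℂ) := by rw [hcr]; exact hne _ (by positivity)
  set f : ℕ → ℂ := fun n => ((ascPochhammer ℂ n).eval c)⁻¹ * (x ^ 2 / 4) ^ n / n.factorial with hf
  have hfs : Summable f := by
    refine Summable.of_norm_bounded
      (Real.summable_pow_div_factorial (‖x ^ 2 / 4‖ / (a + 1 / 2))) fun n => ?_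
    rw [hf, norm_div, norm_mul, norm_inv, norm_pow, Complex.norm_natCast, div_pow]
    have h1 := hpos (a + 1 / 2) n (by positivity)
    rw [← hcr] at h1
    have h2 : 0 < (a + 1 / 2) ^ n := by positivity
    rw [inv_mul_eq_div]
    gcongr
  have hfv : HasSum f (genHypergeometric [] [c] (x ^ 2 / 4)) := by
    have : genHypergeometric [] [c] (x ^ 2 / 4) = ∑' n, f n := by
      rw [genHypergeometric]
      refine tsum_congr fun n => ?_
      simp [hf]
    rw [this]
    exact hfs.hasSum
  -- In the Cauchy product of the exponential and the ₀F₁, the coefficient of xᵏ is a terminating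
  -- Gauss sum at 1 with c = a + 1/2; `hg` below evaluates it by duplication.
  have hprod := (HasSum.mul (f := fun n : ℕ => x ^ n / n.factorial) (g := f)
    (hasSum_pow_div_factorial x) hfv
    (summable_mul_of_summable_norm (f := fun n : ℕ => x ^ n / n.factorial) (g := f)
      (hasSum_pow_div_factorial x).summable.norm hfs.norm)).regroup
  refine (congrArg (fun g => HasSum g _) (funext fun k => ?_)).mp hprod
  have hsum : ∑ n ∈ Finset.range (k / 2 + 1), x ^ (k - 2 * n) / (k - 2 * n).factorial * f n =
      x ^ k / k.factorial * gaussSum₂ k c := by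
    rw [gaussSum₂, Finset.mul_sum]
    refine Finset.sum_congr rfl fun n hn => ?_
    obtain ⟨m, rfl⟩ : ∃ m, k = m + 2 * n := ⟨k - 2 * n, by
      rw [Finset.mem_range] at hn
      omega⟩
    have hP := ascPochhammer_half_neg (show 2 * n ≤ m + 2 * n by omega)
    have hF : ((m + 2 * n).factorial : ℂ) ≠ 0 := by exact_mod_cast Nat.factorial_ne_zero _
    rw [Nat.add_sub_cancel] at hP ⊢
    rw [mul_assoc ((n.factorial : ℂ)⁻¹), hP, hf]
    dsimp only
    rw [pow_add, pow_mul, div_pow]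
    generalize ((m + 2 * n).factorial : ℂ) = F at *
    have : F⁻¹ * F = 1 := inv_mul_cancel₀ hF
    simp only [div_eq_mul_inv, mul_inv]
    linear_combination -(x ^ m * (x ^ 2) ^ n * (m.factorial : ℂ)⁻¹ * (n.factorial : ℂ)⁻¹ *
      ((4 : ℂ) ^ n)⁻¹ * ((ascPochhammer ℂ n).eval c)⁻¹) * this
  rw [hsum]
  have hg : gaussSum₂ k c * (ascPochhammer ℂ k).eval (2 * a : ℂ) =
      2 ^ k * (ascPochhammer ℂ k).eval (a : ℂ) := by
    obtain ⟨N, rfl | rfl⟩ := k.even_or_odd'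
    · rw [gaussSum₂_even N hcne, ascPochhammer_two_mul, two_mul N, ascPochhammer_add_eval,
        show c - (1 - 2 * (N : ℂ)) / 2 = a + N by rw [hc]; ring, pow_add, ← mul_pow]
      have := ascPochhammer_ne_zero_of_ne_neg hcne N
      generalize (ascPochhammer ℂ N).eval c = A at *
      norm_num
      field_simp
    · rw [gaussSum₂_odd N hcne, ascPochhammer_succ_eval_left,
        show (2 * a + 1 : ℂ) = 2 * c by rw [hc]; ring, ascPochhammer_two_mul,
        show 2 * N + 1 = (N + 1) + N by ring, ascPochhammer_add_eval, ascPochhammer_succ_eval_left,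
        show c + 1 / 2 = a + 1 by rw [hc]; ring,
        show c + (2 * (N : ℂ) + 1) / 2 = a + (N + 1 : ℕ) by rw [hc]; push_cast; ring,
        show (2 : ℂ) ^ (N + 1 + N) = 2 * 4 ^ N by
          rw [show (4 : ℂ) = 2 * 2 by norm_num, mul_pow]; ring]
      have := ascPochhammer_ne_zero_of_ne_neg hcne N
      generalize (ascPochhammer ℂ N).eval c = A at *
      field_simp
  have h2a : (ascPochhammer ℂ k).eval (2 * a : ℂ) ≠ 0 := by
    refine ascPochhammer_ne_zero_of_ne_neg ?_ k
    have := hne (2 * a) (by positivity)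
    push_cast at this
    exact this
  rw [← eq_div_iff h2a] at hg
  rw [hg, mul_pow]
  ring

lemma gaussValue_zero : gaussValue 0 = 1 / Gamma (5 / 6) := by
  simpa using gaussValue_even 0

lemma gaussValue_one : gaussValue 1 = 1 / (6 * Gamma (7 / 6)) := by
  have h := gaussValue_odd 0
  have hG := Gamma_add_one (1 / 6) (by norm_num)
  rw [show (1 / 6 : ℂ) + 1 = 7 / 6 by norm_num] at hG
  rw [hG, ← mul_assoc]
  norm_num at h ⊢
  exact h

/-- By `gaussValue_add_three` the ratio of consecutive terms is that of ₁F₁(a; 2a) at 4iz³/27, with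
a = 1/3; the class k ≡ 1 below has a = 2/3. -/
lemma pow_mul_gaussValue_three_mul (z : ℂ) (j : ℕ) :
    (2 * I * z) ^ (3 * j) / (3 * j).factorial * gaussValue (3 * j) = 1 / Gamma (5 / 6) *
      ((ascPochhammer ℂ j).eval (1 / 3) / ((ascPochhammer ℂ j).eval (2 * (1 / 3)) * j.factorial) *
        (2 * (2 * I * z ^ 3 / 27)) ^ j) := by
  induction j with
  | zero => simp [gaussValue_zero]
  | succ j ih =>
    have h1 : (2 * I * z) ^ (3 * (j + 1)) / (3 * (j + 1)).factorial * gaussValue (3 * (j + 1)) =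
        (2 * I * z) ^ (3 * j) / (3 * j).factorial * gaussValue (3 * j) *
          ((1 / 3 + j) / ((2 * (1 / 3) + j) * (j + 1)) * (2 * (2 * I * z ^ 3 / 27))) := by
      rw [show 3 * (j + 1) = 3 * j + 3 by ring, gaussValue_add_three, Nat.factorial_succ,
        Nat.factorial_succ, Nat.factorial_succ, pow_add]
      have e1 : (3 * (j : ℂ) + 1) ≠ 0 := by norm_cast
      have e2 : (3 * (j : ℂ) + 2) ≠ 0 := by norm_cast
      have e3 : (j : ℂ) + 1 ≠ 0 := by norm_cast
      have e4 : ((3 * j).factorial : ℂ) ≠ 0 := by exact_mod_cast Nat.factorial_ne_zero _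
      have e5 : (2 * I * z) ^ 3 = -8 * I * z ^ 3 := by
        rw [mul_pow, mul_pow, I_pow_three]; ring
      rw [e5]
      push_cast
      rw [show (3 * (j : ℂ) + 2 + 1) = 3 * (j + 1) by ring, show (3 * (j : ℂ) + 1 + 1) = 3 * j + 2 by ring,
        show (2 * (1 / 3) + (j : ℂ)) = (3 * j + 2) / 3 by ring]
      field_simp
      ring
    rw [h1, ih, ascPochhammer_succ_eval, ascPochhammer_succ_eval, Nat.factorial_succ, pow_succ]
    push_cast
    simp only [div_eq_mul_inv, mul_inv]
    ring

lemma pow_mul_gaussValue_three_mul_add_one (z : ℂ) (j : ℕ) :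
    (2 * I * z) ^ (1 + 3 * j) / (1 + 3 * j).factorial * gaussValue (1 + 3 * j) =
      I * z / (3 * Gamma (7 / 6)) *
      ((ascPochhammer ℂ j).eval (2 / 3) / ((ascPochhammer ℂ j).eval (2 * (2 / 3)) * j.factorial) *
        (2 * (2 * I * z ^ 3 / 27)) ^ j) := by
  induction j with
  | zero =>
    simp only [mul_zero, add_zero, gaussValue_one]
    simp
    ring
  | succ j ih =>
    have h1 : (2 * I * z) ^ (1 + 3 * (j + 1)) / (1 + 3 * (j + 1)).factorial *
        gaussValue (1 + 3 * (j + 1)) =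
        (2 * I * z) ^ (1 + 3 * j) / (1 + 3 * j).factorial * gaussValue (1 + 3 * j) *
          ((2 / 3 + j) / ((2 * (2 / 3) + j) * (j + 1)) * (2 * (2 * I * z ^ 3 / 27))) := by
      rw [show 1 + 3 * (j + 1) = 1 + 3 * j + 3 by ring, gaussValue_add_three, Nat.factorial_succ,
        Nat.factorial_succ, Nat.factorial_succ, pow_add _ (1 + 3 * j)]
      have e1 : (3 * (j : ℂ) + 2) ≠ 0 := by norm_cast
      have e2 : (3 * (j : ℂ) + 4) ≠ 0 := by norm_cast
      have e3 : (j : ℂ) + 1 ≠ 0 := by norm_cast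
      have e4 : ((1 + 3 * j).factorial : ℂ) ≠ 0 := by exact_mod_cast Nat.factorial_ne_zero _
      have e5 : (2 * I * z) ^ 3 = -8 * I * z ^ 3 := by
        rw [mul_pow, mul_pow, I_pow_three]; ring
      rw [e5]
      push_cast
      rw [show (1 + 3 * (j : ℂ) + 2 + 1) = 3 * j + 4 by ring,
        show (1 + 3 * (j : ℂ) + 1 + 1) = 3 * (j + 1) by ring,
        show (1 + 3 * (j : ℂ) + 1) = 3 * j + 2 by ring,
        show (1 + (1 + 3 * (j : ℂ))) = 3 * j + 2 by ring,
        show (2 * (2 / 3) + (j : ℂ)) = (3 * j + 4) / 3 by ring]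
      field_simp
      ring
    rw [h1, ih, ascPochhammer_succ_eval, ascPochhammer_succ_eval, Nat.factorial_succ, pow_succ]
    push_cast
    simp only [div_eq_mul_inv, mul_inv]
    ring

lemma omegaRoot_pow_three : omegaRoot ^ 3 = 1 := by
  rw [omegaRoot, ← Complex.exp_nat_mul, ← Complex.exp_two_pi_mul_I]
  congr 1
  push_cast
  ring

lemma omegaRoot_eq : omegaRoot = -1 / 2 + Real.sqrt 3 / 2 * I := by
  have : 2 * (Real.pi : ℂ) * I / 3 = ((Real.pi - Real.pi / 3 : ℝ) : ℂ) * I := by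
    push_cast
    ring
  rw [omegaRoot, this, exp_mul_I, ← ofReal_cos, ← ofReal_sin, Real.cos_pi_sub, Real.sin_pi_sub,
    Real.cos_pi_div_three, Real.sin_pi_div_three]
  push_cast
  ring

lemma omegaRoot_im_one : omegaRoot.im = Real.sqrt 3 / 2 := by
  rw [omegaRoot_eq]
  simp

lemma omegaRoot_sq_im : (omegaRoot ^ 2).im = -(Real.sqrt 3 / 2) := by
  rw [omegaRoot_eq]
  simp [pow_two]
  ring

/-- Im ω^{k+1} takes the values √3/2, -√3/2, 0 for k ≡ 0, 1, 2 mod 3. Kummer's transformation with x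
= 2iz³/27 puts the same exponential in front of both surviving series. -/
lemma tsum_rightTerm_zero (z : ℝ) : ∑' k, rightTerm 0 z k =
    Real.sqrt 3 / 2 * exp (2 * I * z ^ 3 / 27) *
      (1 / Gamma (5 / 6) * genHypergeometric [] [5 / 6] (-((z : ℂ) ^ 6 / 3 ^ 6)) -
        I * z / (3 * Gamma (7 / 6)) * genHypergeometric [] [7 / 6] (-((z : ℂ) ^ 6 / 3 ^ 6))) := by
  have hX : (2 * I * (z : ℂ) ^ 3 / 27) ^ 2 / 4 = -((z : ℂ) ^ 6 / 3 ^ 6) := by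
    rw [div_pow, mul_pow, mul_pow, I_sq]
    ring
  have k0 := kummer_second (a := 1 / 3) (by norm_num) (2 * I * (z : ℂ) ^ 3 / 27)
  have k1 := kummer_second (a := 2 / 3) (by norm_num) (2 * I * (z : ℂ) ^ 3 / 27)
  push_cast at k0 k1
  rw [hX, show (1 / 3 + 1 / 2 : ℂ) = 5 / 6 by norm_num] at k0
  rw [hX, show (2 / 3 + 1 / 2 : ℂ) = 7 / 6 by norm_num] at k1
  have h0 : ∀ m, rightTerm 0 z (0 + 3 * m) = (Real.sqrt 3 / 2 : ℂ) * (1 / Gamma (5 / 6) *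
      ((ascPochhammer ℂ m).eval (1 / 3) / ((ascPochhammer ℂ m).eval (2 * (1 / 3)) * m.factorial) *
        (2 * (2 * I * z ^ 3 / 27)) ^ m)) := by
    intro m
    rw [zero_add, rightTerm_zero, pow_mul_gaussValue_three_mul, pow_add, pow_mul,
      omegaRoot_pow_three, one_pow, one_mul, pow_one, omegaRoot_im_one]
    push_cast
    rfl
  have h1 : ∀ m, rightTerm 0 z (1 + 3 * m) = -(Real.sqrt 3 / 2 : ℂ) * (I * z / (3 * Gamma (7 / 6)) *
      ((ascPochhammer ℂ m).eval (2 / 3) / ((ascPochhammer ℂ m).eval (2 * (2 / 3)) * m.factorial) *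
        (2 * (2 * I * z ^ 3 / 27)) ^ m)) := by
    intro m
    rw [rightTerm_zero, pow_mul_gaussValue_three_mul_add_one,
      show 1 + 3 * m + 1 = 3 * m + 2 by ring, pow_add, pow_mul, omegaRoot_pow_three, one_pow,
      one_mul, omegaRoot_sq_im]
    push_cast
    rfl
  have h2 : ∀ m, rightTerm 0 z (2 + 3 * m) = 0 := by
    intro m
    rw [rightTerm_zero, show 2 + 3 * m + 1 = 3 * (m + 1) by ring, pow_mul, omegaRoot_pow_three]
    simp
  rw [Nat.sumByResidueClasses (right_formula 0 z).1 3]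
  have h3 : ∀ g : ZMod 3 → ℂ, ∑ j : ZMod 3, g j = g 0 + g 1 + g 2 := Fin.sum_univ_three
  rw [h3, show (0 : ZMod 3).val = 0 from rfl, show (1 : ZMod 3).val = 1 from rfl,
    show (2 : ZMod 3).val = 2 from rfl]
  simp_rw [h0, h1, h2]
  simp_rw [tsum_mul_left]
  rw [k0.tsum_eq, k1.tsum_eq, tsum_zero]
  ring

lemma rightPrefactor_zero_mul_tsum (z : ℝ) :
    rightPrefactor 0 z * ∑' k, rightTerm 0 z k = berryHowls z := by
  rw [tsum_rightTerm_zero, rightPrefactor, berryHowls]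
  have he : exp ((9 * ((0 : ℝ) : ℂ) - 4) * (I * (z : ℂ) ^ 3 / 27)) * exp (2 * I * z ^ 3 / 27) =
      exp (-(2 * I * (z : ℂ) ^ 3 / 27)) := by
    rw [← Complex.exp_add]
    congr 1
    push_cast
    ring
  rw [← he]
  have h3 : (Real.sqrt 3 : ℂ) ≠ 0 := ofReal_ne_zero.2 (Real.sqrt_pos.2 (by norm_num)).ne'
  generalize exp (2 * I * (z : ℂ) ^ 3 / 27) = A
  generalize exp ((9 * ((0 : ℝ) : ℂ) - 4) * (I * (z : ℂ) ^ 3 / 27)) = B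
  generalize (1 / Gamma (5 / 6) * genHypergeometric [] [5 / 6] (-((z : ℂ) ^ 6 / 3 ^ 6)) -
        I * z / (3 * Gamma (7 / 6)) * genHypergeometric [] [7 / 6] (-((z : ℂ) ^ 6 / 3 ^ 6))) = D
  field_simp

theorem mainTheorem4 :
    (∀ c z : ℝ, UmbilicConverges (c * z ^ 2) 0 z ∧ Summable (rightTerm c z) ∧
      ellipticUmbilic (c * z ^ 2) 0 z = rightPrefactor c z * ∑' k : ℕ, rightTerm c z k) ∧
    (∀ c z : ℝ, UmbilicConverges (-(c * z ^ 2 / 3)) 0 z ∧ Summable (leftTerm c z) ∧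
      ellipticUmbilic (-(c * z ^ 2 / 3)) 0 z = leftPrefactor c z * ∑' k : ℕ, leftTerm c z k) ∧
    (∀ z : ℝ, rightPrefactor 0 z * ∑' k : ℕ, rightTerm 0 z k = berryHowls z ∧
      ellipticUmbilic 0 0 z = berryHowls z) := by
  refine ⟨fun c z => ⟨umbilicConverges _ _, right_formula c z⟩,
    fun c z => ⟨umbilicConverges _ _, left_formula c z⟩,
    fun z => ⟨rightPrefactor_zero_mul_tsum z, ?_⟩⟩
  rw [← rightPrefactor_zero_mul_tsum, ← (right_formula 0 z).2, zero_mul]
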